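/- Let $n\ge 1$, let $(N,J,g)$ be a Kähler manifold of complex dimension $2n$ with Kähler form $\omega(X,Y)=g(JX,Y)$, and let $F:M\to N$ be a smooth immersion of a real $2n$-dimensional manifold $M$, with the induced metric $g_M=F^*g$ and its Levi-Civita connection $\nabla$. Identify the 2-form $F^*\omega$ with the skew-symmetric endomorphism of $TM$ given by $g_M(F^*\omega(X),Y)=F^*\omega(X,Y)$, and let $F^*\omega=|F^*\omega|\,J_\omega$ be its polar decomposition, where $|F^*\omega|=\sqrt{-(F^*\omega)^2}$ and $J_\omega$ is the partial isometry with the same kernel as $F^*\omega$. The Kähler angles of $F$ at $p$ are the $\theta_1\le\dots\le\theta_n$ in $[0,\pi/2]$ for which $T_pM$ has a $g_M$-orthonormal basis $\{X_\alpha,Y_\alpha\}$ with $F^*\omega(X_\alpha)=\cos\theta_\alpha Y_\alpha$ and $F^*\omega(Y_\alpha)=-\cos\theta_\alpha X_\alpha$. Suppose that $F$ has equal Kähler angles: $\theta_1=\dots=\theta_n=\theta$ at every point, with $\theta:M\to[0,\pi/2]$. Let $\Omega^0_{2n}$ be the largest open subset of $M$ on which $F^*\omega$ has constant rank $2n$.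 For an endomorphism field $A$ let $\delta A=-\sum_s(\nabla_{e_s}A)(e_s)$, and for a form $\varphi$ of positive degree let $\delta\varphi=-\sum_s(\nabla_{e_s}\varphi)(e_s,\cdot)$, where $\{e_s\}$ is any local $g_M$-orthonormal basis; at every point of $M$, $\delta F^*\omega$ for the 2-form $F^*\omega$ is the 1-form $g_M$-dual to the vector $\delta F^*\omega$ for the endomorphism. Then $\cos\theta$ and $J_\omega$ are smooth on $\Omega^0_{2n}$, and there $$\delta F^*\omega=(n-2)\,J_\omega(\nabla\cos\theta),\qquad \cos\theta\;\delta J_\omega=(n-1)\,J_\omega(\nabla\cos\theta),$$ where $F^*\omega$ is considered as an endomorphism and $\nabla\cos\theta$ is the gradient with respect to $g_M$. Consequently: (i) If $n=1$, then $\delta J_\omega=0$ on $\Omega^0_{2n}$, and the following are equivalent: $\delta F^*\omega=0$ on $M$; $\delta F^*\omega=0$ on $\Omega^0_{2n}$; $\theta$ is locally constant on $\Omega^0_{2n}$. (ii) If $n=2$, then $F^*\omega$ is co-closed on $M$, that is, $\delta F^*\omega=0$, and hence harmonic, that is, $(d\delta+\delta d)F^*\omega=0$. Moreover, $\delta J_\omega=0$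 on $\Omega^0_{2n}$ iff $\theta$ is locally constant on $\Omega^0_{2n}$. (iii) If $n\ge 3$, the following are equivalent: $\delta F^*\omega=0$ on $M$; $\delta F^*\omega=0$ on $\Omega^0_{2n}$; $\delta J_\omega=0$ on $\Omega^0_{2n}$; $\theta$ is locally constant on $\Omega^0_{2n}$. If $M$ is connected, then $\theta$ is locally constant on $\Omega^0_{2n}$ iff $\theta$ is constant on $M$. -/

import Mathlib

open scoped Manifold ContDiff Topology Bundle

noncomputable section

namespace KahlerAngles

/-! ### Linear algebra of a scalar product `B` on a finite-dimensional real vector space `V` -/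

section LinearAlgebra

variable {V : Type*} [AddCommGroup V] [Module ℝ V] [TopologicalSpace V]

/-- The vector that represents the linear form `ℓ` with respect to `B`: `B (sharp B ℓ) w = ℓ w`. -/
def sharp (B : V →L[ℝ] V →L[ℝ] ℝ) (ℓ : V → ℝ) : V :=
  Classical.epsilon fun v => ∀ w, B v w = ℓ w

/-- The endomorphism that represents the bilinear form `β` with respect to `B`:
`B (sharpEnd B β v) w = β v w`. -/
def sharpEnd (B : V →L[ℝ] V →L[ℝ] ℝ) (β : V → V → ℝ) : V →L[ℝ] V :=
  Classical.epsilon fun T => ∀ v w, B (T v) w = β v w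

/-- The family `e` is orthonormal with respect to `B`. -/
def IsOrthonormal {ι : Type*} (B : V →L[ℝ] V →L[ℝ] ℝ) (e : ι → V) : Prop :=
  (∀ i, B (e i) (e i) = 1) ∧ ∀ i j, i ≠ j → B (e i) (e j) = 0

/-- A `B`-orthonormal basis of `V`. -/
def frame (B : V →L[ℝ] V →L[ℝ] ℝ) : Fin (Module.finrank ℝ V) → V :=
  Classical.epsilon fun e => IsOrthonormal B e

/-- `A = P ∘ J` is the polar decomposition of the `B`-skew-symmetric operator `A`:
`P = √(-A²)` is the positive semidefinite square root and `J` is a partial isometry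
with the same kernel as `A`. -/
structure IsPolarDecomposition (B : V →L[ℝ] V →L[ℝ] ℝ) (A P J : V →L[ℝ] V) : Prop where
  symm : ∀ u v, B (P u) v = B u (P v)
  nonneg : ∀ u, 0 ≤ B (P u) u
  sq : ∀ u, P (P u) = -A (A u)
  decomp : ∀ u, A u = P (J u)
  ker_eq : ∀ u, J u = 0 ↔ A u = 0
  isometry : ∀ u, (∀ k, A k = 0 → B u k = 0) → B (J u) (J u) = B u u

/-- The partial isometry in the polar decomposition of `A`. -/
def polarIsometry (B : V →L[ℝ] V →L[ℝ] ℝ) (A : V →L[ℝ] V) : V →L[ℝ] V :=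
  Classical.epsilon fun J => ∃ P, IsPolarDecomposition B A P J

/-- `θ₁ ≤ … ≤ θₙ` in `[0, π/2]` are the angles of the `B`-skew-symmetric operator `A`: in some
`B`-orthonormal basis `X₁, Y₁, …, Xₙ, Yₙ` of `V`, `A Xᵢ = cos θᵢ Yᵢ` and `A Yᵢ = - cos θᵢ Xᵢ`. -/
def HasAngles {n : ℕ} (B : V →L[ℝ] V →L[ℝ] ℝ) (A : V →L[ℝ] V) (θ : Fin n → ℝ) : Prop :=
  Monotone θ ∧ (∀ i, θ i ∈ Set.Icc 0 (Real.pi / 2)) ∧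
    ∃ X Y : Fin n → V, IsOrthonormal B (Sum.elim X Y) ∧
      Submodule.span ℝ (Set.range (Sum.elim X Y)) = ⊤ ∧
      (∀ i, A (X i) = Real.cos (θ i) • Y i) ∧ (∀ i, A (Y i) = -Real.cos (θ i) • X i)

end LinearAlgebra

/-! ### The scalar products that occur have the vectors and bases chosen above -/

section WellDefined

variable {V : Type*} [NormedAddCommGroup V] [NormedSpace ℝ V] [FiniteDimensional ℝ V]

theorem sharp_spec (B : V →L[ℝ] V →L[ℝ] ℝ) (pos : ∀ v, v ≠ 0 → 0 < B v v) (ℓ : V →ₗ[ℝ] ℝ)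
    (w : V) : B (sharp B ℓ) w = ℓ w := by
  have inj : Function.Injective ((LinearMap.toContinuousLinearMap.symm.toLinearMap :
      (V →L[ℝ] ℝ) →ₗ[ℝ] (V →ₗ[ℝ] ℝ)) ∘ₗ (B : V →ₗ[ℝ] V →L[ℝ] ℝ)) := by
    refine (injective_iff_map_eq_zero _).2 fun v hv => ?_
    by_contra h
    have h1 := pos v h
    have h2 : B v v = 0 := congrArg (fun f : V →ₗ[ℝ] ℝ => f v) hv
    exact h1.ne' h2
  have surj := (LinearMap.injective_iff_surjective_of_finrank_eq_finrank
    (Subspace.dual_finrank_eq (K := ℝ) (V := V)).symm).1 inj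
  obtain ⟨v, hv⟩ := surj ℓ
  exact Classical.epsilon_spec (p := fun v => ∀ w, B v w = ℓ w)
    ⟨v, fun w => congrArg (fun f : V →ₗ[ℝ] ℝ => f w) hv⟩ w

theorem sharpEnd_spec (B : V →L[ℝ] V →L[ℝ] ℝ) (pos : ∀ v, v ≠ 0 → 0 < B v v)
    (β : V →ₗ[ℝ] V →ₗ[ℝ] ℝ) (v w : V) : B (sharpEnd B (fun v w => β v w) v) w = β v w := by
  have inj : ∀ v v', (∀ w, B v w = B v' w) → v = v' := by
    intro v v' h
    by_contra hne
    have h1 := pos (v - v') (sub_ne_zero.2 hne)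
    simp [h] at h1
  let T : V →ₗ[ℝ] V :=
    { toFun := fun v => sharp B (β v)
      map_add' := fun a b => inj _ _ fun w => by
        rw [sharp_spec B pos, map_add, map_add]
        exact (congrArg₂ (· + ·) (sharp_spec B pos (β a) w) (sharp_spec B pos (β b) w)).symm
      map_smul' := fun c a => inj _ _ fun w => by
        rw [sharp_spec B pos, map_smul, map_smul]
        exact (congrArg (c • ·) (sharp_spec B pos (β a) w)).symm }
  refine Classical.epsilon_spec (p := fun T : V →L[ℝ] V => ∀ v w, B (T v) w = β v w)
    ⟨LinearMap.toContinuousLinearMap T, fun v w => ?_⟩ v w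
  exact sharp_spec B pos (β v) w

theorem frame_spec (B : V →L[ℝ] V →L[ℝ] ℝ) (symm : ∀ v w, B v w = B w v)
    (pos : ∀ v, v ≠ 0 → 0 < B v v) : IsOrthonormal B (frame B) := by
  refine Classical.epsilon_spec (p := fun e => IsOrthonormal B e) ?_
  let β : LinearMap.BilinForm ℝ V := LinearMap.mk₂ ℝ (fun v w => B v w)
    (fun _ _ _ => by simp) (fun _ _ _ => by simp) (fun _ _ _ => by simp) (fun _ _ _ => by simp)
  obtain ⟨b, hb⟩ := LinearMap.BilinForm.exists_orthogonal_basis (B := β) ⟨fun v w => symm v w⟩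
  have hpos : ∀ i, 0 < B (b i) (b i) := fun i => pos _ (b.ne_zero i)
  refine ⟨fun i => (√(B (b i) (b i)))⁻¹ • b i, fun i => ?_, fun i j hij => ?_⟩
  · have h1 := Real.sq_sqrt (hpos i).le
    have h2 := Real.sqrt_pos.2 (hpos i)
    simp only [map_smul, smul_apply, smul_eq_mul]
    field_simp
    linarith
  · have h1 : B (b i) (b j) = 0 := hb hij
    simp [h1]

end WellDefined

/-! ### Levi-Civita connection and divergence in a coordinate domain

`G : V → V →L[ℝ] V →L[ℝ] ℝ` is a metric given in coordinates. -/

section Coordinates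

variable {V : Type*} [NormedAddCommGroup V] [NormedSpace ℝ V]

/-- The Christoffel symbols of the Levi-Civita connection of `G` at `x`: `v ↦ Γ(u, v)` with
`G (Γ(u, v)) w = (∂ᵤ G(v, w) + ∂ᵥ G(u, w) - ∂_w G(u, v)) / 2`. -/
def christoffel (G : V → V →L[ℝ] V →L[ℝ] ℝ) (x u : V) : V →L[ℝ] V :=
  sharpEnd (G x) fun v w => (fderiv ℝ G x u v w + fderiv ℝ G x v u w - fderiv ℝ G x w u v) / 2

/-- `(∇ᵤ A) v = ∂ᵤ A v + Γ(u, A v) - A (Γ(u, v))` for a field `A` of endomorphisms. -/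
def covEnd (G : V → V →L[ℝ] V →L[ℝ] ℝ) (A : V → V →L[ℝ] V) (x u : V) : V →L[ℝ] V :=
  fderiv ℝ A x u + christoffel G x u ∘L A x - A x ∘L christoffel G x u

/-- `δ A = - ∑ₛ (∇_{eₛ} A) eₛ`, with `e` a `G`-orthonormal basis. -/
def coordDeltaEnd (G : V → V →L[ℝ] V →L[ℝ] ℝ) (A : V → V →L[ℝ] V) (x : V) : V :=
  -∑ s, covEnd G A x (frame (G x) s) (frame (G x) s)

/-- The alternating form `v ↦ ∑ᵢ φ(v₁, …, T vᵢ, …, v_k)`, for an endomorphism `T`. -/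
def derivation {k : ℕ} (T : V →L[ℝ] V) (φ : V [⋀^Fin k]→L[ℝ] ℝ) : V [⋀^Fin k]→L[ℝ] ℝ :=
  { toContinuousMultilinearMap := ∑ i, φ.toContinuousMultilinearMap.compContinuousLinearMap
      (fun j => if j = i then T else ContinuousLinearMap.id ℝ V)
    map_eq_zero_of_eq' := by
      intro v a b hv hab
      classical
      have key : ∀ i, φ.toContinuousMultilinearMap.compContinuousLinearMap
          (fun j => if j = i then T else ContinuousLinearMap.id ℝ V) v
            = φ (Function.update v i (T (v i))) := fun i => by
        refine congrArg φ (funext fun j => ?_)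
        rcases eq_or_ne j i with rfl | h <;> simp_all
      show (∑ i, φ.toContinuousMultilinearMap.compContinuousLinearMap
          (fun j => if j = i then T else ContinuousLinearMap.id ℝ V)) v = 0
      rw [sum_apply, Finset.sum_congr rfl fun i _ => key i,
        ← Finset.add_sum_erase _ _ (Finset.mem_univ a),
        ← Finset.add_sum_erase _ _ (Finset.mem_erase.2 ⟨hab.symm, Finset.mem_univ b⟩),
        Finset.sum_eq_zero, add_zero]
      · have h : Function.update v b (T (v b))
            = Function.update v a (T (v a)) ∘ Equiv.swap a b := by
          funext j
          rcases eq_or_ne j a with rfl | ha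
          · simp [hab, hv, hab.symm]
          · rcases eq_or_ne j b with rfl | hb
            · simp [hv]
            · simp [Equiv.swap_apply_of_ne_of_ne, ha, hb]
        rw [h, show φ (Function.update v a (T (v a)) ∘ Equiv.swap a b)
            = -φ (Function.update v a (T (v a))) from φ.toAlternatingMap.map_swap _ hab,
          add_neg_cancel]
      · intro i hi
        simp only [Finset.mem_erase, Finset.mem_univ, and_true] at hi
        exact φ.map_eq_zero_of_eq _ (by simp [hi.1.symm, hi.2.symm, hv]) hab }

theorem derivation_apply {k : ℕ} (T : V →L[ℝ] V) (φ : V [⋀^Fin k]→L[ℝ] ℝ) (v : Fin k → V) :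
    derivation T φ v = ∑ i, φ (Function.update v i (T (v i))) := by
  show (∑ i, φ.toContinuousMultilinearMap.compContinuousLinearMap
      (fun j => if j = i then T else ContinuousLinearMap.id ℝ V)) v = _
  rw [sum_apply]
  refine Finset.sum_congr rfl fun i _ => congrArg φ (funext fun j => ?_)
  rcases eq_or_ne j i with rfl | h <;> simp_all

/-- `(∇ᵤ φ)(v₁, …, v_k) = ∂ᵤ φ(v₁, …, v_k) - ∑ᵢ φ(v₁, …, Γ(u, vᵢ), …, v_k)` for a `k`-form `φ`. -/
def covForm {k : ℕ} (G : V → V →L[ℝ] V →L[ℝ] ℝ) (φ : V → V [⋀^Fin k]→L[ℝ] ℝ) (x u : V) :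
    V [⋀^Fin k]→L[ℝ] ℝ :=
  fderiv ℝ φ x u - derivation (christoffel G x u) (φ x)

/-- `δ φ (v₁, …, v_k) = - ∑ₛ (∇_{eₛ} φ)(eₛ, v₁, …, v_k)`, with `e` a `G`-orthonormal basis. -/
def coordDeltaForm {k : ℕ} (G : V → V →L[ℝ] V →L[ℝ] ℝ) (φ : V → V [⋀^Fin (k + 1)]→L[ℝ] ℝ)
    (x : V) : V [⋀^Fin k]→L[ℝ] ℝ :=
  -∑ s, (covForm G φ x (frame (G x) s)).curryLeft (frame (G x) s)

end Coordinates

/-! ### Tensor fields on a manifold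

`X` is a manifold without boundary modelled on `V`.  The tangent space of `X` at `q` is, by
definition, `V`, identified through the chart at `q`; so a field of endomorphisms of the tangent
spaces is a map `X → V →L[ℝ] V`, and similarly for forms and metrics.  In particular the value at
`p` of an expression computed in the chart at `p` is a tensor on the tangent space at `p`. -/

section Manifold

variable {V : Type*} [NormedAddCommGroup V] [NormedSpace ℝ V]
  {X : Type*} [TopologicalSpace X] [ChartedSpace V X]

/-- The differential at `y` of the inverse of the chart at `p`. -/
def dSymm (p : X) (y : V) : V →L[ℝ] V :=
  mfderiv 𝓘(ℝ, V) 𝓘(ℝ, V) (chartAt V p).symm y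

/-- The differential of the chart at `p` at the point with coordinate `y`. -/
def dChart (p : X) (y : V) : V →L[ℝ] V :=
  mfderiv 𝓘(ℝ, V) 𝓘(ℝ, V) (chartAt V p) ((chartAt V p).symm y)

/-- A field of bilinear forms in the coordinates of the chart at `p`. -/
def chartBilin (B : X → V →L[ℝ] V →L[ℝ] ℝ) (p : X) (y : V) : V →L[ℝ] V →L[ℝ] ℝ :=
  (B ((chartAt V p).symm y)).bilinearComp (dSymm p y) (dSymm p y)

/-- A field of endomorphisms in the coordinates of the chart at `p`. -/
def chartEnd (A : X → V →L[ℝ] V) (p : X) (y : V) : V →L[ℝ] V :=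
  dChart p y ∘L A ((chartAt V p).symm y) ∘L dSymm p y

/-- A differential form in the coordinates of the chart at `p`. -/
def chartForm {k : ℕ} (φ : X → V [⋀^Fin k]→L[ℝ] ℝ) (p : X) (y : V) : V [⋀^Fin k]→L[ℝ] ℝ :=
  (φ ((chartAt V p).symm y)).compContinuousLinearMap (dSymm p y)

/-- The exterior derivative of a differential form. -/
def extD {k : ℕ} (φ : X → V [⋀^Fin k]→L[ℝ] ℝ) (p : X) : V [⋀^Fin (k + 1)]→L[ℝ] ℝ :=
  extDeriv (chartForm φ p) (chartAt V p p)

/-- The divergence `δ A = - ∑ₛ (∇_{eₛ} A) eₛ` of a field of endomorphisms, with respect to the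
Levi-Civita connection of the Riemannian metric `B`. -/
def deltaEnd (B : X → V →L[ℝ] V →L[ℝ] ℝ) (A : X → V →L[ℝ] V) (p : X) : V :=
  coordDeltaEnd (chartBilin B p) (chartEnd A p) (chartAt V p p)

/-- The codifferential `δ φ = - ∑ₛ (∇_{eₛ} φ)(eₛ, ·)` of a differential form, with respect to the
Levi-Civita connection of the Riemannian metric `B`. -/
def deltaForm {k : ℕ} (B : X → V →L[ℝ] V →L[ℝ] ℝ) (φ : X → V [⋀^Fin (k + 1)]→L[ℝ] ℝ) (p : X) :
    V [⋀^Fin k]→L[ℝ] ℝ :=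
  coordDeltaForm (chartBilin B p) (chartForm φ p) (chartAt V p p)

/-- The Laplacian `d δ + δ d` on forms of positive degree. -/
def hodgeLaplacian {k : ℕ} (B : X → V →L[ℝ] V →L[ℝ] ℝ) (φ : X → V [⋀^Fin (k + 1)]→L[ℝ] ℝ)
    (p : X) : V [⋀^Fin (k + 1)]→L[ℝ] ℝ :=
  extD (deltaForm B φ) p + deltaForm B (extD φ) p

/-- The gradient of a function with respect to the Riemannian metric `B`. -/
def gradient (B : X → V →L[ℝ] V →L[ℝ] ℝ) (f : X → ℝ) (p : X) : V :=
  sharp (B p) (mfderiv 𝓘(ℝ, V) 𝓘(ℝ, ℝ) f p : V →L[ℝ] ℝ)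

end Manifold

/-! ### Kähler manifolds

A complex manifold `N` is a manifold modelled on a complex vector space `W` with holomorphic
coordinate changes.  Its real tangent bundle is that of the underlying real manifold. -/

section Kahler

/-- The real manifold underlying a complex manifold. -/
instance isManifold_real {W : Type*} [NormedAddCommGroup W] [NormedSpace ℂ W]
    {N : Type*} [TopologicalSpace N] [ChartedSpace W N] [IsManifold 𝓘(ℂ, W) ∞ N] :
    IsManifold 𝓘(ℝ, W) ∞ N := by
  refine isManifold_of_contDiffOn _ _ _ fun e e' he he' => ?_
  have h := (HasGroupoid.compatible (G := contDiffGroupoid ∞ 𝓘(ℂ, W)) he he')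
  rw [contDiffGroupoid, mem_groupoid_of_pregroupoid] at h
  have h1 : ContDiffOn ℂ ∞ (e.symm ≫ₕ e') (e.symm ≫ₕ e').source := by
    simpa [contDiffPregroupoid] using h.1
  simpa using h1.restrict_scalars ℝ

variable {W : Type*} [NormedAddCommGroup W] [NormedSpace ℂ W]

variable (W) in
/-- The complex structure of the tangent spaces: multiplication by `i` in a holomorphic chart. -/
def complexJ : W →L[ℝ] W :=
  Complex.I • ContinuousLinearMap.id ℝ W

variable {N : Type*} [TopologicalSpace N] [ChartedSpace W N] [IsManifold 𝓘(ℂ, W) ∞ N]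

/-- The scalar product of a smooth Riemannian metric on the tangent space at `x`. -/
def scalarProduct
    (g : Bundle.ContMDiffRiemannianMetric 𝓘(ℝ, W) ∞ W (TangentSpace 𝓘(ℝ, W) : N → Type _))
    (x : N) : W →L[ℝ] W →L[ℝ] ℝ :=
  g.inner x

variable (W N) in
/-- A Hermitian metric on a complex manifold: a smooth Riemannian metric `g` such that the complex
structure is `g`-orthogonal. -/
structure HermitianMetric where
  metric : Bundle.ContMDiffRiemannianMetric 𝓘(ℝ, W) ∞ W (TangentSpace 𝓘(ℝ, W) : N → Type _)
  orthogonal : ∀ (x : N) (u v : W),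
    scalarProduct metric x (complexJ W u) (complexJ W v) = scalarProduct metric x u v

/-- The scalar product of a Hermitian metric on the tangent space at `x`. -/
def HermitianMetric.g (h : HermitianMetric W N) (x : N) : W →L[ℝ] W →L[ℝ] ℝ :=
  scalarProduct h.metric x

theorem HermitianMetric.g_complexJ_self (h : HermitianMetric W N) (x : N) (u : W) :
    h.g x (complexJ W u) u = 0 := by
  have h1 : h.g x (complexJ W (complexJ W u)) (complexJ W u) = h.g x (complexJ W u) u :=
    h.orthogonal x (complexJ W u) u
  have h2 : h.g x (complexJ W u) u = h.g x u (complexJ W u) :=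
    h.metric.symm x (complexJ W u) u
  have h3 : complexJ W (complexJ W u) = -u := by simp [complexJ, smul_smul]
  rw [h3, map_neg, neg_apply] at h1
  linarith

/-- The fundamental form `ω(u, v) = g(J u, v)`. -/
def HermitianMetric.omega (h : HermitianMetric W N) (x : N) : W [⋀^Fin 2]→L[ℝ] ℝ :=
  { toFun := fun v => h.g x (complexJ W (v 0)) (v 1)
    map_update_add' := fun v i u w => by
      fin_cases i <;> simp
    map_update_smul' := fun v i c u => by
      fin_cases i <;> simp
    map_eq_zero_of_eq' := fun v i j hv hij => by
      have key := h.g_complexJ_self x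
      fin_cases i <;> fin_cases j <;> simp_all
    cont := by fun_prop }

/-- A Hermitian metric is Kähler if its fundamental form is closed. -/
def HermitianMetric.IsKahler (h : HermitianMetric W N) : Prop :=
  ∀ x, extD h.omega x = 0

end Kahler

/-! ### Immersions into Kähler manifolds -/

section Immersions

variable {W : Type*} [NormedAddCommGroup W] [NormedSpace ℂ W]
  {N : Type*} [TopologicalSpace N] [ChartedSpace W N] [IsManifold 𝓘(ℂ, W) ∞ N]
  {V : Type*} [NormedAddCommGroup V] [NormedSpace ℝ V]
  {M : Type*} [TopologicalSpace M] [ChartedSpace V M]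

variable (W V) in
/-- The differential of `F` at `p`. -/
def differential (F : M → N) (p : M) : V →L[ℝ] W :=
  mfderiv 𝓘(ℝ, V) 𝓘(ℝ, W) F p

variable (V) in
/-- The induced metric `F^* g` on `M`. -/
def inducedMetric (h : HermitianMetric W N) (F : M → N) (p : M) : V →L[ℝ] V →L[ℝ] ℝ :=
  (h.g (F p)).bilinearComp (differential W V F p) (differential W V F p)

variable (V) in
/-- The 2-form `F^* ω` on `M`. -/
def pullbackForm (h : HermitianMetric W N) (F : M → N) (p : M) : V [⋀^Fin 2]→L[ℝ] ℝ :=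
  (h.omega (F p)).compContinuousLinearMap (differential W V F p)

variable (V) in
/-- `F^* ω` as a field of endomorphisms of the tangent spaces of `M`:
`g_M (F^* ω (u), v) = F^* ω (u, v)`. -/
def pullbackEnd (h : HermitianMetric W N) (F : M → N) (p : M) : V →L[ℝ] V :=
  sharpEnd (inducedMetric V h F p) fun u v => pullbackForm V h F p ![u, v]

variable (V) in
/-- The partial isometry `J_ω` in the polar decomposition of `F^* ω`. -/
def Jomega (h : HermitianMetric W N) (F : M → N) (p : M) : V →L[ℝ] V :=
  polarIsometry (inducedMetric V h F p) (pullbackEnd V h F p)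

variable (V) in
/-- `Ω⁰_{2k}`: the largest open set on which `F^* ω` has constant rank `2k`. -/
def constantRankSet (h : HermitianMetric W N) (F : M → N) (k : ℕ) : Set M :=
  interior {p | Module.finrank ℝ (LinearMap.range (pullbackEnd V h F p).toLinearMap) = 2 * k}

variable (V) in
/-- `F` has equal Kähler angles: at each point `p` its `n` Kähler angles are all equal to `θ p`. -/
def HasEqualKahlerAngles (n : ℕ) (h : HermitianMetric W N) (F : M → N) (θ : M → ℝ) : Prop :=
  ∀ p, HasAngles (inducedMetric V h F p) (pullbackEnd V h F p) fun _ : Fin n => θ p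

end Immersions

end KahlerAngles

end

/-! Let `A` be the endomorphism of `F^*ω`. Equal Kähler angles mean `A² = -f` with `f = cos²θ`, a
scalar that is smooth on all of `M`. Write `D` for `∇A`. Three facts hold at every point: each `D u`
is skew; `D u ∘ A + A ∘ D u = -df(u)`, by differentiating `A² = -f`; and the cyclic sum of `⟨D u v,
w⟩` vanishes, because `F^*ω` is closed and the connection is torsion-free.

Put `u = eₛ`, `v = A eₛ` in the cyclic identity and sum over an orthonormal frame. The first two
terms both give `⟨A δA, w⟩ - df(w)`, and the third is minus the trace of `A ∘ D w`, which the
anticommutation relation evaluates to `(dim/2) df(w)`. Hence `⟨A δA, w⟩ = (1 - dim/4) df(w)`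
(`IsOrthonormal.apply_divergence`), that is, `A δA = (1 - n/2) ∇cos²θ` in dimension `2n`.

Since `A² = -cos²θ`, the set `Ω⁰` is where `cos θ ≠ 0`; there `cos θ = √f` is smooth and `J_ω = A /
cos θ`. Applying `A` once more gives the formula for `δA` (`deltaEnd_pullbackEnd`), and the Leibniz
rule for `A = cos θ J_ω` gives the one for `δJ_ω` (`cos_smul_deltaEnd_Jomega`). As `J_ω` is
injective on `Ω⁰`, the equivalences there depend only on whether `n - 2` and `n - 1` vanish.

Co-closedness passes from `Ω⁰` to `M` by continuity: if `δA ≠ 0` at a point, then `δA ≠ 0` nearby,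
so the neighbourhood misses `Ω⁰`, so `A = 0` on it and `δA = 0`
(`coordDeltaEnd_eq_zero_of_ne_zero`). Local constancy on `Ω⁰` becomes constancy on a connected `M`
because nonzero level sets of `cos²θ` are then clopen. -/

noncomputable section

namespace KahlerAngles

/-! ### Pointwise algebra: contractions over an orthonormal basis. -/

section Algebra

variable {V : Type*} [NormedAddCommGroup V] [NormedSpace ℝ V]

theorem eq_of_forall_apply_eq {B : V →L[ℝ] V →L[ℝ] ℝ} (pos : ∀ v, v ≠ 0 → 0 < B v v) {v v' : V}
    (h : ∀ w, B v w = B v' w) : v = v' := by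
  by_contra hne
  have h1 := pos (v - v') (sub_ne_zero.2 hne)
  simp [h] at h1

variable [FiniteDimensional ℝ V]

theorem IsOrthonormal.sum_smul_eq {B : V →L[ℝ] V →L[ℝ] ℝ} {e : Fin (Module.finrank ℝ V) → V}
    (he : IsOrthonormal B e) (v : V) : ∑ s, B v (e s) • e s = v := by
  have hB : ∀ i j, B (e i) (e j) = if i = j then 1 else 0 := fun i j => by
    split_ifs with h
    · rw [h]; exact he.1 j
    · exact he.2 i j h
  have li : LinearIndependent ℝ e := by
    rw [Fintype.linearIndependent_iff]
    intro c hc i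
    have h1 : B (∑ j, c j • e j) (e i) = 0 := by rw [hc]; simp
    simpa [hB] using h1
  have hs := li.span_eq_top_of_card_eq_finrank' (by simp)
  have hv : v ∈ Submodule.span ℝ (Set.range e) := hs ▸ Submodule.mem_top
  obtain ⟨c, rfl⟩ := (Submodule.mem_span_range_iff_exists_fun ℝ).1 hv
  simp [hB]

theorem IsOrthonormal.trace_eq {B : V →L[ℝ] V →L[ℝ] ℝ} {e : Fin (Module.finrank ℝ V) → V}
    (he : IsOrthonormal B e) (T : V →L[ℝ] V) :
    LinearMap.trace ℝ V T.toLinearMap = ∑ s, B (T (e s)) (e s) := by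
  have hT : T.toLinearMap = ∑ s, ((B.flip (e s)).comp T).toLinearMap.smulRight (e s) := by
    ext v
    simp [he.sum_smul_eq]
  rw [hT, map_sum]
  simp [LinearMap.trace_smulRight]

variable {V' : Type*} [AddCommGroup V'] [Module ℝ V']

/-- The matrix of `A` in an orthonormal basis is antisymmetric, so moving `A` from one slot of a
contraction to the other costs a sign. -/
theorem IsOrthonormal.sum_apply_skew {B : V →L[ℝ] V →L[ℝ] ℝ}
    {e : Fin (Module.finrank ℝ V) → V} (he : IsOrthonormal B e)
    {A : V →L[ℝ] V} (skew : ∀ v w, B (A v) w = -B (A w) v) (T : V →ₗ[ℝ] V →ₗ[ℝ] V') :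
    ∑ s, T (A (e s)) (e s) = -∑ s, T (e s) (A (e s)) := by
  have h1 : ∀ s, T (A (e s)) (e s) = ∑ t, B (A (e s)) (e t) • T (e t) (e s) := fun s => by
    conv_lhs => rw [← he.sum_smul_eq (A (e s))]
    simp
  have h2 : ∀ s, T (e s) (A (e s)) = ∑ t, B (A (e s)) (e t) • T (e s) (e t) := fun s => by
    conv_lhs => rw [← he.sum_smul_eq (A (e s))]
    simp
  simp_rw [h1, h2]
  rw [Finset.sum_comm, ← Finset.sum_neg_distrib]
  refine Finset.sum_congr rfl fun s _ => ?_
  rw [← Finset.sum_neg_distrib]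
  refine Finset.sum_congr rfl fun t _ => ?_
  rw [skew (e t) (e s), neg_smul]

/-- The contraction over an orthonormal basis, in terms of an arbitrary basis. -/
theorem IsOrthonormal.sum_apply_self {B : V →L[ℝ] V →L[ℝ] ℝ} {e : Fin (Module.finrank ℝ V) → V} (he : IsOrthonormal B e)
    {ι : Type*} [Fintype ι] (b : Module.Basis ι ℝ V) {r : ι → V}
    (hr : ∀ i w, B (r i) w = b.repr w i) (T : V →ₗ[ℝ] V →ₗ[ℝ] V') :
    ∑ s, T (e s) (e s) = ∑ i, T (r i) (b i) := by
  have h1 : ∀ s, T (e s) (e s) = ∑ i, B (r i) (e s) • T (e s) (b i) := fun s => by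
    conv_lhs => enter [2]; rw [← b.sum_repr (e s)]
    simp only [map_sum, map_smul, hr]
  have h2 : ∀ i, T (r i) (b i) = ∑ s, B (r i) (e s) • T (e s) (b i) := fun i => by
    conv_lhs => rw [← he.sum_smul_eq (r i)]
    simp
  simp_rw [h1, h2]
  exact Finset.sum_comm

/-- The divergence of a closed 2-form whose operator `A` satisfies `A² = -f`: here `D u` is the
covariant derivative of `A` in the direction `u`, and `f'` is the differential of `f`. -/
theorem IsOrthonormal.apply_divergence {B : V →L[ℝ] V →L[ℝ] ℝ} (symm : ∀ v w, B v w = B w v)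
    {e : Fin (Module.finrank ℝ V) → V} (he : IsOrthonormal B e)
    {A : V →L[ℝ] V} (skew : ∀ v w, B (A v) w = -B (A w) v) (D : V →ₗ[ℝ] V →ₗ[ℝ] V)
    (f' : V →L[ℝ] ℝ) (hD : ∀ u v w, B (D u v) w = -B (D u w) v)
    (anti : ∀ u v, D u (A v) + A (D u v) = -(f' u • v))
    (cyc : ∀ u v w, B (D u v) w + B (D v w) u + B (D w u) v = 0) (w : V) :
    B (A (-∑ s, D (e s) (e s))) w = (1 - (Module.finrank ℝ V : ℝ) / 4) * f' w := by
  have hf : ∑ s, f' (e s) * B (e s) w = f' w := by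
    conv_rhs => rw [← he.sum_smul_eq w]
    simp [symm w, mul_comm]
  -- First term of the cyclic sum: anticommute `D (e s)` past `A`, which leaves the divergence and
  -- the gradient term.
  have h1 : ∑ s, B (D (e s) (A (e s))) w = B (A (-∑ s, D (e s) (e s))) w - f' w := by
    have : ∀ s, B (D (e s) (A (e s))) w = -(f' (e s) * B (e s) w) - B (A (D (e s) (e s))) w :=
      fun s => by
        rw [eq_sub_of_add_eq (anti (e s) (e s))]
        simp
    simp_rw [this, Finset.sum_sub_distrib, Finset.sum_neg_distrib, hf]
    simp
    ring
  -- Second term: the sign from skewness of `D` and the sign from `sum_apply_skew` cancel, so it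
  -- equals the first.
  have h2 : ∑ s, B (D (A (e s)) w) (e s) = ∑ s, B (D (e s) (A (e s))) w := by
    have := he.sum_apply_skew skew (D.compr₂ (B.flip w).toLinearMap)
    simp only [LinearMap.compr₂_apply, ContinuousLinearMap.coe_coe,
      ContinuousLinearMap.flip_apply] at this
    rw [← neg_eq_iff_eq_neg] at this
    rw [← this, ← Finset.sum_neg_distrib]
    exact Finset.sum_congr rfl fun s _ => hD _ _ _
  -- Third term: it is `-tr (A ∘ D w)`. Both orders of the product have the same trace, and they add
  -- up to `-f' w` times the identity, whence half of the dimension.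
  have h3 : ∑ s, B (D w (e s)) (A (e s)) = (Module.finrank ℝ V : ℝ) / 2 * f' w := by
    have a1 : ∀ s, B (D w (e s)) (A (e s)) = -B (A (D w (e s))) (e s) := fun s => by
      rw [symm, skew]
    have a2 := he.trace_eq (A ∘L (D w).toContinuousLinearMap)
    have a3 := he.trace_eq ((D w).toContinuousLinearMap ∘L A)
    have a4 : LinearMap.trace ℝ V (A ∘L (D w).toContinuousLinearMap).toLinearMap
        = LinearMap.trace ℝ V ((D w).toContinuousLinearMap ∘L A).toLinearMap :=
      LinearMap.trace_mul_comm ℝ A.toLinearMap (D w)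
    have a5 : ∑ s, B (((D w).toContinuousLinearMap ∘L A) (e s)) (e s)
        = -(Module.finrank ℝ V : ℝ) * f' w
          - ∑ s, B ((A ∘L (D w).toContinuousLinearMap) (e s)) (e s) := by
      rw [eq_sub_iff_add_eq, ← Finset.sum_add_distrib]
      have : ∀ s, B (((D w).toContinuousLinearMap ∘L A) (e s)) (e s)
          + B ((A ∘L (D w).toContinuousLinearMap) (e s)) (e s) = -f' w := fun s => by
        have := congrArg (fun z => B z (e s)) (anti w (e s))
        simpa [he.1 s] using this
      simp_rw [this]
      simp
    simp only [a1, Finset.sum_neg_distrib]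
    rw [← a2, ← a3] at a5
    simp only [ContinuousLinearMap.comp_apply, LinearMap.coe_toContinuousLinearMap'] at a2
    rw [← a2]
    linarith
  -- The cyclic identity at `(e s, A (e s), w)`.
  have h4 : ∑ s, (B (D (e s) (A (e s))) w + B (D (A (e s)) w) (e s)
      + B (D w (e s)) (A (e s))) = 0 := Finset.sum_eq_zero fun s _ => cyc _ _ _
  rw [Finset.sum_add_distrib, Finset.sum_add_distrib, h2, h1, h3] at h4
  linarith

end Algebra

/-! ### The Levi-Civita connection in coordinates and the divergence identity. -/

section CoordinateFields

open Filter

variable {V : Type*} [NormedAddCommGroup V] [NormedSpace ℝ V] [FiniteDimensional ℝ V]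
  {G : V → V →L[ℝ] V →L[ℝ] ℝ} {A : V → V →L[ℝ] V} {x : V}

theorem christoffel_spec (pos : ∀ v, v ≠ 0 → 0 < G x v v) (u v w : V) :
    G x (christoffel G x u v) w
      = (fderiv ℝ G x u v w + fderiv ℝ G x v u w - fderiv ℝ G x w u v) / 2 := by
  let β : V →ₗ[ℝ] V →ₗ[ℝ] ℝ := LinearMap.mk₂ ℝ
    (fun v w => (fderiv ℝ G x u v w + fderiv ℝ G x v u w - fderiv ℝ G x w u v) / 2)
    (fun a b c => by
      rw [(fderiv ℝ G x).map_add]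
      simp only [ContinuousLinearMap.map_add, add_apply]
      ring)
    (fun r a b => by
      rw [(fderiv ℝ G x).map_smul]
      simp only [ContinuousLinearMap.map_smul, smul_apply, smul_eq_mul]
      ring)
    (fun a b c => by
      rw [(fderiv ℝ G x).map_add]
      simp only [ContinuousLinearMap.map_add, add_apply]
      ring)
    (fun r a b => by
      rw [(fderiv ℝ G x).map_smul]
      simp only [ContinuousLinearMap.map_smul, smul_apply, smul_eq_mul]
      ring)
  exact sharpEnd_spec (G x) pos β v w

omit [FiniteDimensional ℝ V] in
theorem fderiv_metric_symm (hG : DifferentiableAt ℝ G x)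
    (symm : ∀ᶠ y in 𝓝 x, ∀ v w, G y v w = G y w v) (u v w : V) :
    fderiv ℝ G x u v w = fderiv ℝ G x u w v := by
  have key : ∀ v w, fderiv ℝ (fun y => G y v w) x u = fderiv ℝ G x u v w := fun v w => by
    rw [fderiv_clm_apply (by fun_prop) (by fun_prop), fderiv_clm_apply (by fun_prop) (by fun_prop)]
    simp
  rw [← key, ← key]
  refine congrArg (fun L : V →L[ℝ] ℝ => L u) (EventuallyEq.fderiv_eq ?_)
  filter_upwards [symm] with y hy using hy v w

/-- The connection is torsion-free. -/
theorem christoffel_symm (hG : DifferentiableAt ℝ G x) (pos : ∀ v, v ≠ 0 → 0 < G x v v)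
    (symm : ∀ᶠ y in 𝓝 x, ∀ v w, G y v w = G y w v) (u v : V) :
    christoffel G x u v = christoffel G x v u := by
  refine eq_of_forall_apply_eq pos fun w => ?_
  rw [christoffel_spec pos, christoffel_spec pos, fderiv_metric_symm hG symm w u v]
  ring

/-- Compatibility with the metric, `∇G = 0`. -/
theorem fderiv_metric (hG : DifferentiableAt ℝ G x) (pos : ∀ v, v ≠ 0 → 0 < G x v v)
    (symm : ∀ᶠ y in 𝓝 x, ∀ v w, G y v w = G y w v) (u v w : V) :
    fderiv ℝ G x u v w = G x (christoffel G x u v) w + G x v (christoffel G x u w) := by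
  rw [symm.self_of_nhds v, christoffel_spec pos, christoffel_spec pos,
    fderiv_metric_symm hG symm u w v]
  ring

omit [FiniteDimensional ℝ V] in
theorem covEnd_apply (A : V → V →L[ℝ] V) (x u v : V) :
    covEnd G A x u v
      = fderiv ℝ A x u v + christoffel G x u (A x v) - A x (christoffel G x u v) := rfl

/-- The covariant derivative of a field of endomorphisms as a bilinear map. -/
def covEndBilin (A : V → V →L[ℝ] V) (hG : DifferentiableAt ℝ G x)
    (pos : ∀ v, v ≠ 0 → 0 < G x v v)
    (symm : ∀ᶠ y in 𝓝 x, ∀ v w, G y v w = G y w v) : V →ₗ[ℝ] V →ₗ[ℝ] V :=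
  LinearMap.mk₂ ℝ (fun u v => covEnd G A x u v)
    -- `christoffel G x u` is chosen separately for each `u`, so linearity in `u` is not built in;
    -- torsion-freeness moves `u` into the slot that is linear by construction.
    (fun a b c => by
      simp only [covEnd_apply, christoffel_symm hG pos symm _ c, map_add, add_apply,
        christoffel_symm hG pos symm _ (A x c)]
      abel)
    (fun a b c => by
      simp only [covEnd_apply, christoffel_symm hG pos symm _ c, map_smul, smul_apply,
        christoffel_symm hG pos symm _ (A x c), smul_add, smul_sub])
    (fun _ _ _ => map_add _ _ _) (fun _ _ _ => map_smul _ _ _)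

variable {φ : V → V [⋀^Fin 2]→L[ℝ] ℝ}

omit [FiniteDimensional ℝ V] in
theorem form_swap (ψ : V [⋀^Fin 2]→L[ℝ] ℝ) (v w : V) : ψ ![v, w] = -ψ ![w, v] := by
  have := ψ.toAlternatingMap.map_swap ![w, v] (i := 0) (j := 1) (by simp)
  rw [show ![w, v] ∘ Equiv.swap (0 : Fin 2) 1 = ![v, w] by ext i; fin_cases i <;> rfl] at this
  exact this

omit [FiniteDimensional ℝ V] in
theorem derivation_apply_two (T : V →L[ℝ] V) (ψ : V [⋀^Fin 2]→L[ℝ] ℝ) (v w : V) :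
    derivation T ψ ![v, w] = ψ ![T v, w] + ψ ![v, T w] := by
  rw [derivation_apply, Fin.sum_univ_two]
  congr 2 <;> ext i <;> fin_cases i <;> rfl

omit [FiniteDimensional ℝ V] in
theorem fderiv_form_apply (hφ : DifferentiableAt ℝ φ x) (u : V) (v : Fin 2 → V) :
    fderiv ℝ (fun y => φ y v) x u = fderiv ℝ φ x u v := by
  rw [fderiv_continuousAlternatingMap_apply_const_apply hφ]

/-- Because `∇G = 0`, lowering an index commutes with covariant differentiation. -/
theorem covForm_apply (hG : DifferentiableAt ℝ G x) (pos : ∀ v, v ≠ 0 → 0 < G x v v)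
    (symm : ∀ᶠ y in 𝓝 x, ∀ v w, G y v w = G y w v)
    (hA : DifferentiableAt ℝ A x) (hφ : DifferentiableAt ℝ φ x)
    (dual : ∀ᶠ y in 𝓝 x, ∀ v w, G y (A y v) w = φ y ![v, w]) (u v w : V) :
    covForm G φ x u ![v, w] = G x (covEnd G A x u v) w := by
  have h1 : fderiv ℝ φ x u ![v, w] = fderiv ℝ G x u (A x v) w + G x (fderiv ℝ A x u v) w := by
    rw [← fderiv_form_apply hφ]
    have : (fun y => φ y ![v, w]) =ᶠ[𝓝 x] fun y => G y (A y v) w := by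
      filter_upwards [dual] with y hy using (hy v w).symm
    have hAv : DifferentiableAt ℝ (fun y => A y v) x := by fun_prop
    rw [this.fderiv_eq, fderiv_clm_apply (hG.clm_apply hAv) (by fun_prop),
      fderiv_clm_apply hG hAv, fderiv_clm_apply hA (by fun_prop)]
    simp [add_comm]
  have h2 : derivation (christoffel G x u) (φ x) ![v, w]
      = G x (A x (christoffel G x u v)) w + G x (A x v) (christoffel G x u w) := by
    rw [derivation_apply_two, dual.self_of_nhds, dual.self_of_nhds]
  rw [covForm, ContinuousAlternatingMap.sub_apply, h1, h2, fderiv_metric hG pos symm, covEnd_apply]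
  simp
  ring

theorem coordDeltaForm_apply (hG : DifferentiableAt ℝ G x) (pos : ∀ v, v ≠ 0 → 0 < G x v v)
    (symm : ∀ᶠ y in 𝓝 x, ∀ v w, G y v w = G y w v)
    (hA : DifferentiableAt ℝ A x) (hφ : DifferentiableAt ℝ φ x)
    (dual : ∀ᶠ y in 𝓝 x, ∀ v w, G y (A y v) w = φ y ![v, w]) (v : V) :
    coordDeltaForm G φ x ![v] = G x (coordDeltaEnd G A x) v := by
  rw [coordDeltaForm, coordDeltaEnd]
  rw [ContinuousAlternatingMap.neg_apply, ContinuousAlternatingMap.sum_apply, map_neg, map_sum,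
    neg_apply, sum_apply]
  congr 1
  refine Finset.sum_congr rfl fun s _ => ?_
  exact covForm_apply hG pos symm hA hφ dual _ _ _

theorem covEnd_skew (hG : DifferentiableAt ℝ G x) (pos : ∀ v, v ≠ 0 → 0 < G x v v)
    (symm : ∀ᶠ y in 𝓝 x, ∀ v w, G y v w = G y w v)
    (hA : DifferentiableAt ℝ A x) (hφ : DifferentiableAt ℝ φ x)
    (dual : ∀ᶠ y in 𝓝 x, ∀ v w, G y (A y v) w = φ y ![v, w]) (u v w : V) :
    G x (covEnd G A x u v) w = -G x (covEnd G A x u w) v := by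
  rw [← covForm_apply hG pos symm hA hφ dual, ← covForm_apply hG pos symm hA hφ dual,
    form_swap]

/-- For a torsion-free connection the exterior derivative of a 2-form is the cyclic sum of its
covariant derivative: the Christoffel terms cancel in pairs. -/
theorem covEnd_cyclic (hG : DifferentiableAt ℝ G x) (pos : ∀ v, v ≠ 0 → 0 < G x v v)
    (symm : ∀ᶠ y in 𝓝 x, ∀ v w, G y v w = G y w v)
    (hA : DifferentiableAt ℝ A x) (hφ : DifferentiableAt ℝ φ x)
    (dual : ∀ᶠ y in 𝓝 x, ∀ v w, G y (A y v) w = φ y ![v, w]) (closed : extDeriv φ x = 0)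
    (u v w : V) :
    G x (covEnd G A x u v) w + G x (covEnd G A x v w) u + G x (covEnd G A x w u) v = 0 := by
  have h1 : fderiv ℝ φ x u ![v, w] - fderiv ℝ φ x v ![u, w] + fderiv ℝ φ x w ![u, v] = 0 := by
    have := congrArg (fun ψ => ψ ![u, v, w]) closed
    rw [extDeriv_apply hφ] at this
    simp only [fderiv_form_apply hφ] at this
    rw [Fin.sum_univ_three] at this
    have e0 : (0 : Fin 3).removeNth ![u, v, w] = ![v, w] := by
      ext i; fin_cases i <;> rfl
    have e1 : (1 : Fin 3).removeNth ![u, v, w] = ![u, w] := by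
      ext i; fin_cases i <;> rfl
    have e2 : (2 : Fin 3).removeNth ![u, v, w] = ![u, v] := by
      ext i; fin_cases i <;> rfl
    rw [e0, e1, e2] at this
    simpa [sub_eq_add_neg] using! this
  have h2 : ∀ u v w, fderiv ℝ φ x u ![v, w] = G x (covEnd G A x u v) w
      + G x (A x (christoffel G x u v)) w + G x (A x v) (christoffel G x u w) := fun u v w => by
    rw [← covForm_apply hG pos symm hA hφ dual, covForm, ContinuousAlternatingMap.sub_apply,
      derivation_apply_two, dual.self_of_nhds, dual.self_of_nhds]
    ring
  have h3 : ∀ v w, G x (A x v) w = -G x (A x w) v := fun v w => by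
    rw [dual.self_of_nhds, dual.self_of_nhds, form_swap]
  rw [h2, h2, h2, christoffel_symm hG pos symm v u, christoffel_symm hG pos symm w u,
    christoffel_symm hG pos symm w v, h3 v (christoffel G x u w),
    h3 u (christoffel G x v w), covEnd_skew hG pos symm hA hφ dual v u w] at h1
  linarith

omit [FiniteDimensional ℝ V] in
-- Differentiate `A² = -f`. The Christoffel terms form the commutator of `christoffel G x u` with
-- `A²`, which is zero because `A²` is a scalar.
theorem covEnd_anticomm {f : V → ℝ} (hf : DifferentiableAt ℝ f x) (hA : DifferentiableAt ℝ A x)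
    (sq : ∀ᶠ y in 𝓝 x, ∀ v, A y (A y v) = -(f y • v)) (u v : V) :
    covEnd G A x u (A x v) + A x (covEnd G A x u v) = -(fderiv ℝ f x u • v) := by
  have h1 : fderiv ℝ A x u (A x v) + A x (fderiv ℝ A x u v) = -(fderiv ℝ f x u • v) := by
    have e1 : fderiv ℝ (fun y => A y (A y v)) x u
        = A x (fderiv ℝ A x u v) + fderiv ℝ A x u (A x v) := by
      rw [fderiv_clm_apply (by fun_prop) (by fun_prop), fderiv_clm_apply (by fun_prop) (by fun_prop)]
      simp
    have e2 : (fun y => A y (A y v)) =ᶠ[𝓝 x] fun y => -(f y • v) := by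
      filter_upwards [sq] with y hy using hy v
    rw [add_comm, ← e1, e2.fderiv_eq, fderiv_fun_neg, fderiv_smul_const hf]
    simp
  rw [covEnd_apply, covEnd_apply, sq.self_of_nhds, map_sub, map_add, sq.self_of_nhds, ← h1]
  simp
  abel

theorem apply_coordDeltaEnd {f : V → ℝ} (hf : DifferentiableAt ℝ f x)
    (hG : DifferentiableAt ℝ G x) (pos : ∀ v, v ≠ 0 → 0 < G x v v)
    (symm : ∀ᶠ y in 𝓝 x, ∀ v w, G y v w = G y w v)
    (hA : DifferentiableAt ℝ A x) (hφ : DifferentiableAt ℝ φ x)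
    (dual : ∀ᶠ y in 𝓝 x, ∀ v w, G y (A y v) w = φ y ![v, w]) (closed : extDeriv φ x = 0)
    (sq : ∀ᶠ y in 𝓝 x, ∀ v, A y (A y v) = -(f y • v)) (w : V) :
    G x (A x (coordDeltaEnd G A x)) w
      = (1 - (Module.finrank ℝ V : ℝ) / 4) * fderiv ℝ f x w := by
  refine IsOrthonormal.apply_divergence symm.self_of_nhds
    (frame_spec (G x) symm.self_of_nhds pos) (fun v w => ?_) (covEndBilin A hG pos symm) _
    (fun u v w => covEnd_skew hG pos symm hA hφ dual u v w)
    (fun u v => covEnd_anticomm hf hA sq u v)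
    (fun u v w => covEnd_cyclic hG pos symm hA hφ dual closed u v w) w
  rw [dual.self_of_nhds, dual.self_of_nhds, form_swap]

omit [FiniteDimensional ℝ V] in
theorem coordDeltaEnd_congr {A' : V → V →L[ℝ] V} (h : A =ᶠ[𝓝 x] A') :
    coordDeltaEnd G A x = coordDeltaEnd G A' x := by
  simp only [coordDeltaEnd, covEnd, h.fderiv_eq, h.self_of_nhds]

/-- Leibniz rule; the derivative of the factor is contracted to `∑ dc(eₛ) eₛ`, which is the gradient
of `c`. -/
theorem coordDeltaEnd_smul {J : V → V →L[ℝ] V} {c : V → ℝ} (hc : DifferentiableAt ℝ c x)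
    (hJ : DifferentiableAt ℝ J x) (symm : ∀ v w, G x v w = G x w v)
    (pos : ∀ v, v ≠ 0 → 0 < G x v v) :
    coordDeltaEnd G (fun y => c y • J y) x
      = c x • coordDeltaEnd G J x - J x (sharp (G x) (fderiv ℝ c x)) := by
  have h1 : ∀ u v, covEnd G (fun y => c y • J y) x u v
      = c x • covEnd G J x u v + fderiv ℝ c x u • J x v := fun u v => by
    rw [covEnd_apply, covEnd_apply, fderiv_fun_smul hc hJ]
    simp [smul_sub, smul_add]
    abel
  have h2 : sharp (G x) (fderiv ℝ c x)
      = ∑ s, fderiv ℝ c x (frame (G x) s) • frame (G x) s := by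
    refine ((frame_spec (G x) symm pos).sum_smul_eq _).symm.trans ?_
    exact Finset.sum_congr rfl fun s _ =>
      congrArg (· • frame (G x) s) (sharp_spec (G x) pos (fderiv ℝ c x).toLinearMap _)
  simp only [coordDeltaEnd, h1, h2, map_sum, map_smul, Finset.sum_add_distrib, smul_neg,
    Finset.smul_sum]
  abel

omit [FiniteDimensional ℝ V] in
theorem coordDeltaEnd_eq_zero (h : A =ᶠ[𝓝 x] 0) : coordDeltaEnd G A x = 0 := by
  have h1 : fderiv ℝ A x = 0 := by rw [h.fderiv_eq]; exact fderiv_const_apply _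
  have h2 : A x = 0 := h.self_of_nhds
  simp [coordDeltaEnd, covEnd_apply, h1, h2]

end CoordinateFields

/-! ### Smoothness of dual endomorphisms and continuity of the divergence. -/

section CoordinateRegularity

open Filter

variable {V : Type*} [NormedAddCommGroup V] [NormedSpace ℝ V] [FiniteDimensional ℝ V]

theorem contDiffAt_of_forall_apply {E F : Type*} [NormedAddCommGroup E] [NormedSpace ℝ E]
    [NormedAddCommGroup F] [NormedSpace ℝ F] {k : WithTop ℕ∞} {f : E → V →L[ℝ] F} {x : E}
    (h : ∀ v, ContDiffAt ℝ k (fun y => f y v) x) : ContDiffAt ℝ k f x := by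
  let e₁ : V ≃L[ℝ] (Fin (Module.finrank ℝ V) → ℝ) :=
    ContinuousLinearEquiv.ofFinrankEq (by simp)
  let e₂ := (e₁.arrowCongr (1 : F ≃L[ℝ] F)).trans
    (ContinuousLinearEquiv.piRing (Fin (Module.finrank ℝ V)))
  rw [← Function.id_comp f, ← e₂.symm_comp_self]
  exact e₂.symm.contDiff.contDiffAt.comp x (contDiffAt_pi.mpr fun i => h _)

theorem isInvertible_of_pos {B : V →L[ℝ] V →L[ℝ] ℝ} (pos : ∀ v, v ≠ 0 → 0 < B v v) :
    B.IsInvertible := by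
  have inj : Function.Injective B := fun v v' h =>
    eq_of_forall_apply_eq pos fun w => by rw [h]
  have surj : Function.Surjective B := fun ℓ =>
    ⟨sharp B ℓ, ContinuousLinearMap.ext fun w => sharp_spec B pos ℓ.toLinearMap w⟩
  exact ⟨(LinearEquiv.ofBijective B.toLinearMap ⟨inj, surj⟩).toContinuousLinearEquiv, by
    ext; rfl⟩

theorem inverse_spec {B : V →L[ℝ] V →L[ℝ] ℝ} (pos : ∀ v, v ≠ 0 → 0 < B v v) (ℓ : V →L[ℝ] ℝ) :
    B (B.inverse ℓ) = ℓ :=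
  (isInvertible_of_pos pos).self_apply_inverse ℓ

variable {G : V → V →L[ℝ] V →L[ℝ] ℝ} {A : V → V →L[ℝ] V} {x : V}

theorem contDiffAt_inverse_metric {k : WithTop ℕ∞} (hG : ContDiffAt ℝ k G x)
    (pos : ∀ v, v ≠ 0 → 0 < G x v v) : ContDiffAt ℝ k (fun y => (G y).inverse) x :=
  (isInvertible_of_pos pos).contDiffAt_map_inverse.comp x hG

/-- `A` is `G⁻¹ ∘ β`, and inversion is smooth at invertible maps. -/
theorem contDiffAt_of_dual {k : WithTop ℕ∞} (hG : ContDiffAt ℝ k G x)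
    (pos : ∀ᶠ y in 𝓝 x, ∀ v, v ≠ 0 → 0 < G y v v) {β : V → V →L[ℝ] V →L[ℝ] ℝ}
    (hβ : ContDiffAt ℝ k β x) (dual : ∀ᶠ y in 𝓝 x, ∀ v w, G y (A y v) w = β y v w) :
    ContDiffAt ℝ k A x := by
  refine ((contDiffAt_inverse_metric hG pos.self_of_nhds).clm_comp hβ).congr_of_eventuallyEq ?_
  filter_upwards [pos, dual] with y hy hd
  ext1 v
  refine eq_of_forall_apply_eq hy fun w => ?_
  rw [hd, ContinuousLinearMap.comp_apply, inverse_spec hy]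

set_option synthInstance.maxHeartbeats 200000 in
theorem continuousAt_christoffel (hG : ContDiffAt ℝ 1 G x)
    (pos : ∀ᶠ y in 𝓝 x, ∀ v, v ≠ 0 → 0 < G y v v) {u v : V → V} (hu : ContinuousAt u x)
    (hv : ContinuousAt v x) : ContinuousAt (fun y => christoffel G y (u y) (v y)) x := by
  have hG' := hG.continuousAt_fderiv one_ne_zero
  have hi := (contDiffAt_inverse_metric hG pos.self_of_nhds).continuousAt
  have h1 : ContinuousAt (fun y => ((fderiv ℝ G y).flip (u y)).flip (v y)) x :=
    continuousAt_clm_apply.2 fun w =>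
      ((hG'.clm_apply continuousAt_const).clm_apply hu).clm_apply hv
  have hℓ := ((((hG'.clm_apply hu).clm_apply hv).add
    ((hG'.clm_apply hv).clm_apply hu)).sub h1).const_smul (1 / 2 : ℝ)
  refine (hi.clm_apply hℓ).congr ?_
  filter_upwards [pos] with y hy
  refine eq_of_forall_apply_eq hy fun w => ?_
  rw [inverse_spec hy, christoffel_spec hy]
  simp
  ring

/-- `frame (G y)` is chosen at each point with no continuity in `y`. The contraction does not depend
on the frame, so it can be written with a fixed basis `b` and the vectors `G⁻¹ bⁱ` dual to it, which
vary continuously. -/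
theorem continuousAt_coordDeltaEnd (hG : ContDiffAt ℝ 1 G x) (hA : ContDiffAt ℝ 1 A x)
    (pos : ∀ᶠ y in 𝓝 x, ∀ v, v ≠ 0 → 0 < G y v v)
    (symm : ∀ᶠ y in 𝓝 x, ∀ v w, G y v w = G y w v) :
    ContinuousAt (coordDeltaEnd G A) x := by
  let b := Module.finBasis ℝ V
  let ℓ : Fin (Module.finrank ℝ V) → V →L[ℝ] ℝ := fun i => (b.coord i).toContinuousLinearMap
  have hi := (contDiffAt_inverse_metric hG pos.self_of_nhds).continuousAt
  have hr : ∀ i, ContinuousAt (fun y => (G y).inverse (ℓ i)) x := fun i =>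
    hi.clm_apply continuousAt_const
  have hA' : ContinuousAt (fderiv ℝ A) x := hA.continuousAt_fderiv (by simp)
  have hc : ContinuousAt (fun y => -∑ i, covEnd G A y ((G y).inverse (ℓ i)) (b i)) x := by
    refine ContinuousAt.neg (tendsto_finsetSum _ fun i _ => ?_)
    simp only [covEnd_apply]
    exact (((hA'.clm_apply (hr i)).clm_apply continuousAt_const).add
      (continuousAt_christoffel hG pos (hr i) (hA.continuousAt.clm_apply continuousAt_const))).sub
      (hA.continuousAt.clm_apply (continuousAt_christoffel hG pos (hr i) continuousAt_const))
  refine hc.congr ?_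
  filter_upwards [pos, symm.eventually_nhds, (hG.eventually (by simp))] with y hy hs hGy
  rw [coordDeltaEnd]
  refine congrArg Neg.neg (Eq.symm ?_)
  refine (frame_spec (G y) hs.self_of_nhds hy).sum_apply_self b (fun i w => ?_)
    (covEndBilin A (hGy.differentiableAt (by simp)) hy hs)
  rw [inverse_spec hy]
  rfl

/-- A divergence that vanishes wherever the field does not, vanishes identically. -/
theorem coordDeltaEnd_eq_zero_of_ne_zero (hG : ContDiffAt ℝ 1 G x) (hA : ContDiffAt ℝ 1 A x)
    (pos : ∀ᶠ y in 𝓝 x, ∀ v, v ≠ 0 → 0 < G y v v)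
    (symm : ∀ᶠ y in 𝓝 x, ∀ v w, G y v w = G y w v)
    (h : ∀ᶠ y in 𝓝 x, A y ≠ 0 → coordDeltaEnd G A y = 0) : coordDeltaEnd G A x = 0 := by
  by_contra hne
  have h1 := (continuousAt_coordDeltaEnd hG hA pos symm).eventually_ne hne
  -- Near `x` the divergence stays nonzero, so `h` forces the field to vanish there, and the
  -- divergence of a locally vanishing field is zero.
  refine hne (coordDeltaEnd_eq_zero ?_)
  filter_upwards [h, h1] with y hy hy1
  by_contra hy2
  exact hy1 (hy hy2)

variable (V) in
/-- The antisymmetrization of bilinear forms. -/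
def antisymmetrization : (V →L[ℝ] V →L[ℝ] ℝ) →ₗ[ℝ] V [⋀^Fin 2]→L[ℝ] ℝ where
  toFun β :=
    { toFun := fun v => β (v 0) (v 1) - β (v 1) (v 0)
      map_update_add' := fun v i u w => by fin_cases i <;> simp <;> ring
      map_update_smul' := fun v i c u => by fin_cases i <;> simp <;> ring
      map_eq_zero_of_eq' := fun v i j hv hij => by
        fin_cases i <;> fin_cases j <;> simp_all
      cont := by fun_prop }
  map_add' β γ := by
    ext v
    change (β (v 0) (v 1) + γ (v 0) (v 1)) - (β (v 1) (v 0) + γ (v 1) (v 0))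
      = (β (v 0) (v 1) - β (v 1) (v 0)) + (γ (v 0) (v 1) - γ (v 1) (v 0))
    ring
  map_smul' c β := by
    ext v
    change c * β (v 0) (v 1) - c * β (v 1) (v 0) = c * (β (v 0) (v 1) - β (v 1) (v 0))
    ring

omit [FiniteDimensional ℝ V] in
theorem antisymmetrization_apply (β : V →L[ℝ] V →L[ℝ] ℝ) (v w : V) :
    antisymmetrization V β ![v, w] = β v w - β w v := rfl

set_option synthInstance.maxHeartbeats 200000 in
-- The form is half the antisymmetrization of its bilinear form, hence the image of `β` under a
-- fixed continuous linear map.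
theorem contDiffAt_form {k : WithTop ℕ∞} {β : V → V →L[ℝ] V →L[ℝ] ℝ}
    {φ : V → V [⋀^Fin 2]→L[ℝ] ℝ} (hβ : ContDiffAt ℝ k β x)
    (h : ∀ᶠ y in 𝓝 x, ∀ v w, β y v w = φ y ![v, w]) : ContDiffAt ℝ k φ x := by
  have hL : Continuous (antisymmetrization V) :=
    LinearMap.continuous_of_finiteDimensional (E := V →L[ℝ] V →L[ℝ] ℝ)
      (F' := V [⋀^Fin 2]→L[ℝ] ℝ) (antisymmetrization V)
  let L : (V →L[ℝ] V →L[ℝ] ℝ) →L[ℝ] V [⋀^Fin 2]→L[ℝ] ℝ := ⟨antisymmetrization V, hL⟩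
  have h1 : ContDiffAt ℝ k (fun y => (1 / 2 : ℝ) • L (β y)) x :=
    (L.contDiff.contDiffAt.comp x hβ).const_smul _
  refine h1.congr_of_eventuallyEq ?_
  filter_upwards [h] with y hy
  ext v
  obtain ⟨a, b, rfl⟩ : ∃ a b, v = ![a, b] := ⟨v 0, v 1, by ext i; fin_cases i <;> rfl⟩
  rw [ContinuousAlternatingMap.smul_apply, show L (β y) = antisymmetrization V (β y) from rfl,
    antisymmetrization_apply, hy, hy, form_swap (φ y) b a, smul_eq_mul]
  ring

end CoordinateRegularity

/-! ### Charts and the identification of tangent spaces with the model space. -/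

section Charts

open Filter

variable {V : Type*} [NormedAddCommGroup V] [NormedSpace ℝ V]
  {X : Type*} [TopologicalSpace X] [ChartedSpace V X] [IsManifold 𝓘(ℝ, V) ∞ X]

omit [NormedSpace ℝ V] [IsManifold 𝓘(ℝ, V) ∞ X] in
theorem eventually_mem_chart_target {p : X} {y : V} (hy : y ∈ (chartAt V p).target) :
    ∀ᶠ z in 𝓝 y, z ∈ (chartAt V p).target :=
  (chartAt V p).open_target.mem_nhds hy

omit [NormedSpace ℝ V] [IsManifold 𝓘(ℝ, V) ∞ X] in
theorem chart_self_mem_target (p : X) : chartAt V p p ∈ (chartAt V p).target :=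
  (chartAt V p).map_source (mem_chart_source V p)

omit [NormedSpace ℝ V] [IsManifold 𝓘(ℝ, V) ∞ X] in
theorem chart_symm_self (p : X) : (chartAt V p).symm (chartAt V p p) = p :=
  (chartAt V p).left_inv (mem_chart_source V p)

theorem contMDiffAt_chart_symm {p : X} {y : V} (hy : y ∈ (chartAt V p).target) :
    ContMDiffAt 𝓘(ℝ, V) 𝓘(ℝ, V) ∞ (chartAt V p).symm y :=
  contMDiffOn_chart_symm.contMDiffAt (eventually_mem_chart_target hy)

theorem mdifferentiableAt_chart_symm {p : X} {y : V} (hy : y ∈ (chartAt V p).target) :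
    MDifferentiableAt 𝓘(ℝ, V) 𝓘(ℝ, V) (chartAt V p).symm y :=
  (contMDiffAt_chart_symm hy).mdifferentiableAt (by simp)

theorem dChart_dSymm {p : X} {y : V} (hy : y ∈ (chartAt V p).target) (v : V) :
    dChart p y (dSymm p y v) = v := by
  have : IsManifold 𝓘(ℝ, V) 1 X := .of_le (n := ∞) (by simp)
  have h := (mdifferentiable_chart (I := 𝓘(ℝ, V)) p).comp_symm_deriv hy
  exact congrArg (fun L : V →L[ℝ] V => L v) h

theorem dSymm_dChart {p : X} {y : V} (hy : y ∈ (chartAt V p).target) (v : V) :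
    dSymm p y (dChart p y v) = v := by
  have : IsManifold 𝓘(ℝ, V) 1 X := .of_le (n := ∞) (by simp)
  have h := (mdifferentiable_chart (I := 𝓘(ℝ, V)) p).symm_comp_deriv
    ((chartAt V p).map_target hy)
  rw [(chartAt V p).right_inv hy] at h
  exact congrArg (fun L : V →L[ℝ] V => L v) h

theorem dChart_self (p : X) : dChart p (chartAt V p p) = ContinuousLinearMap.id ℝ V := by
  have : IsManifold 𝓘(ℝ, V) 1 X := .of_le (n := ∞) (by simp)
  rw [dChart, chart_symm_self]
  exact mfderiv_extChartAt_self (I := 𝓘(ℝ, V)) (x := p)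

theorem dSymm_self (p : X) : dSymm p (chartAt V p p) = ContinuousLinearMap.id ℝ V := by
  ext v
  have := dSymm_dChart (chart_self_mem_target p) v
  rwa [dChart_self] at this

/-- Vectors at a point are read in the preferred chart at that point, so the differential of an
inverse chart is the derivative of a coordinate change. -/
theorem dSymm_eq_fderiv {p : X} {y : V} (hy : y ∈ (chartAt V p).target) :
    dSymm p y = fderiv ℝ (chartAt V ((chartAt V p).symm y) ∘ (chartAt V p).symm) y := by
  have h := mdifferentiableAt_chart_symm hy
  refine h.mfderiv.trans ?_
  simp [writtenInExtChartAt, extChartAt, chartAt_self_eq]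
  rfl

theorem chartBilin_self (B : X → V →L[ℝ] V →L[ℝ] ℝ) (p : X) :
    chartBilin B p (chartAt V p p) = B p := by
  rw [chartBilin, dSymm_self, chart_symm_self]
  rfl

theorem chartEnd_self (A : X → V →L[ℝ] V) (p : X) :
    chartEnd A p (chartAt V p p) = A p := by
  rw [chartEnd, dSymm_self, dChart_self, chart_symm_self]
  rfl

omit [IsManifold 𝓘(ℝ, V) ∞ X] in
theorem mfderiv_eq_fderiv_chart {f : X → ℝ} {p : X}
    (hf : MDifferentiableAt 𝓘(ℝ, V) 𝓘(ℝ, ℝ) f p) :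
    (mfderiv 𝓘(ℝ, V) 𝓘(ℝ, ℝ) f p : V →L[ℝ] ℝ)
      = fderiv ℝ (f ∘ (chartAt V p).symm) (chartAt V p p) := by
  refine hf.mfderiv.trans ?_
  simp [writtenInExtChartAt, extChartAt, chartAt_self_eq]
  rfl

theorem contMDiffAt_iff_contDiffAt_chart {f : X → ℝ} {p : X} :
    ContMDiffAt 𝓘(ℝ, V) 𝓘(ℝ, ℝ) ∞ f p
      ↔ ContDiffAt ℝ ∞ (f ∘ (chartAt V p).symm) (chartAt V p p) := by
  constructor
  · intro h
    refine contMDiffAt_iff_contDiffAt.1 (ContMDiffAt.comp _ ?_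
      (contMDiffAt_chart_symm (chart_self_mem_target p)))
    rwa [chart_symm_self]
  · intro h
    have h1 : ContMDiffAt 𝓘(ℝ, V) 𝓘(ℝ, V) ∞ (chartAt V p) p :=
      contMDiffOn_chart.contMDiffAt ((chartAt V p).open_source.mem_nhds (mem_chart_source V p))
    refine (ContMDiffAt.comp p h.contMDiffAt h1).congr_of_eventuallyEq ?_
    filter_upwards [(chartAt V p).open_source.mem_nhds (mem_chart_source V p)] with q hq
    simp [(chartAt V p).left_inv hq]

/-- The vector fields that are constant in a chart are smooth at its centre. -/
theorem contMDiffAt_dSymm (p : X) (u : V) :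
    ContMDiffAt 𝓘(ℝ, V) (𝓘(ℝ, V).prod 𝓘(ℝ, V)) ∞
      (fun q => Bundle.TotalSpace.mk' V (E := (TangentSpace 𝓘(ℝ, V) : X → Type _)) q
        (dSymm p (chartAt V p q) u)) p := by
  have : IsManifold 𝓘(ℝ, V) 1 X := .of_le (n := ∞) (by simp)
  refine (Bundle.contMDiffAt_section (F := V) (E := (TangentSpace 𝓘(ℝ, V) : X → Type _))
    (s := fun q => dSymm p (chartAt V p q) u) p).2 ?_
  -- In the trivialization of the tangent bundle at `p` this field is the constant `u`.
  refine (contMDiffAt_const (c := u)).congr_of_eventuallyEq ?_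
  filter_upwards [(chartAt V p).open_source.mem_nhds (mem_chart_source V p)] with q hq
  let e := trivializationAt V (TangentSpace 𝓘(ℝ, V) : X → Type _) p
  have hq' : q ∈ e.baseSet := by simpa [e] using hq
  have h1 : dSymm p (chartAt V p q) u = e.symmL ℝ q u := by
    rw [TangentBundle.symmL_trivializationAt hq]
    simp only [dSymm, modelWithCornersSelf_coe, Set.range_id, mfderivWithin_univ]
    rfl
  have h2 := e.continuousLinearMapAt_symmL (R := ℝ) hq' u
  rw [e.continuousLinearMapAt_apply ℝ, e.coe_linearMapAt_of_mem hq', ← h1] at h2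
  exact h2

end Charts

/-! ### The Hermitian metric and its fundamental form in holomorphic charts. -/

section HermitianCharts

open Filter

variable {W : Type*} [NormedAddCommGroup W] [NormedSpace ℂ W]
  {N : Type*} [TopologicalSpace N] [ChartedSpace W N] [IsManifold 𝓘(ℂ, W) ∞ N]

/-- Coordinate changes are holomorphic, so their real derivatives are complex linear. -/
theorem dSymm_complexJ {m : N} {z : W} (hz : z ∈ (chartAt W m).target) (u : W) :
    dSymm m z (complexJ W u) = complexJ W (dSymm m z u) := by
  rw [dSymm_eq_fderiv hz]
  set e := chartAt W m
  set e' := chartAt W (e.symm z)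
  have h := HasGroupoid.compatible (G := contDiffGroupoid ∞ 𝓘(ℂ, W)) (chart_mem_atlas W m)
    (chart_mem_atlas W (e.symm z))
  rw [contDiffGroupoid, mem_groupoid_of_pregroupoid] at h
  have h1 : ContDiffOn ℂ ∞ (e.symm ≫ₕ e') (e.symm ≫ₕ e').source := by
    simpa [contDiffPregroupoid] using h.1
  have hs : z ∈ (e.symm ≫ₕ e').source := by
    simp [e', e, hz]
  have h2 : DifferentiableAt ℂ (e' ∘ e.symm) z :=
    (h1.contDiffAt ((e.symm ≫ₕ e').open_source.mem_nhds hs)).differentiableAt (by simp)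
  rw [h2.fderiv_restrictScalars ℝ]
  simp [complexJ]

/-- The coefficients of the metric are its values on chart-constant fields, so smoothness as a
section of the bundle gives smoothness of each coefficient. -/
theorem contDiffAt_chartBilin_metric [FiniteDimensional ℂ W] (h : HermitianMetric W N) (m : N) :
    ContDiffAt ℝ ∞ (chartBilin h.g m) (chartAt W m m) := by
  have : FiniteDimensional ℝ W := FiniteDimensional.complexToReal W
  refine contDiffAt_of_forall_apply fun u => contDiffAt_of_forall_apply fun v => ?_
  have h1 : ContMDiffAt 𝓘(ℝ, W) (𝓘(ℝ, W).prod 𝓘(ℝ, ℝ)) ∞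
      (fun q => Bundle.TotalSpace.mk' ℝ (E := Bundle.Trivial N ℝ) q
        (h.g q (dSymm m (chartAt W m q) u) (dSymm m (chartAt W m q) v))) m :=
    ContMDiffAt.clm_bundle_apply₂ (F₁ := W) (F₂ := W) (F₃ := ℝ) (b := fun q => q)
      (E₁ := (TangentSpace 𝓘(ℝ, W) : N → Type _)) (E₂ := (TangentSpace 𝓘(ℝ, W) : N → Type _))
      (E₃ := Bundle.Trivial N ℝ) h.metric.contMDiff.contMDiffAt
      (contMDiffAt_dSymm m u) (contMDiffAt_dSymm m v)
  have h2 := ((Bundle.contMDiffAt_totalSpace (F := ℝ) (E := Bundle.Trivial N ℝ)).1 h1).2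
  have h3 := contMDiffAt_iff_contDiffAt_chart.1 h2
  refine h3.congr_of_eventuallyEq ?_
  filter_upwards [eventually_mem_chart_target (chart_self_mem_target (V := W) m)] with z hz
  simp [chartBilin, (chartAt W m).right_inv hz]

theorem chartForm_omega (h : HermitianMetric W N) {m : N} {z : W}
    (hz : z ∈ (chartAt W m).target) (u v : W) :
    chartForm h.omega m z ![u, v] = chartBilin h.g m z (complexJ W u) v := by
  change h.g _ (complexJ W (dSymm m z u)) (dSymm m z v) = _
  rw [← dSymm_complexJ hz]
  rfl

theorem contDiffAt_chartForm_omega [FiniteDimensional ℂ W] (h : HermitianMetric W N) (m : N) :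
    ContDiffAt ℝ ∞ (chartForm h.omega m) (chartAt W m m) := by
  have : FiniteDimensional ℝ W := FiniteDimensional.complexToReal W
  have h1 := (contDiffAt_chartBilin_metric h m).clm_comp
    (contDiffAt_const (c := complexJ W))
  refine contDiffAt_form h1 ?_
  filter_upwards [eventually_mem_chart_target (chart_self_mem_target (V := W) m)] with z hz u v
  rw [chartForm_omega h hz]
  rfl

end HermitianCharts

/-! ### The induced metric and `F^*ω` in charts: smoothness and closedness. -/

section ImmersionCharts

open Filter

variable {W : Type*} [NormedAddCommGroup W] [NormedSpace ℂ W]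
  {N : Type*} [TopologicalSpace N] [ChartedSpace W N] [IsManifold 𝓘(ℂ, W) ∞ N]
  {V : Type*} [NormedAddCommGroup V] [NormedSpace ℝ V]
  {M : Type*} [TopologicalSpace M] [ChartedSpace V M] [IsManifold 𝓘(ℝ, V) ∞ M]

/-- The map `F` in the charts at `p` and `m`. -/
def chartMap (V : Type*) [NormedAddCommGroup V] [ChartedSpace V M] (F : M → N) (p : M) (m : N) :
    V → W :=
  chartAt W m ∘ F ∘ (chartAt V p).symm

variable {F : M → N} {p : M} {m : N} {y : V}

theorem contDiffAt_chartMap (hF : ContMDiff 𝓘(ℝ, V) 𝓘(ℝ, W) ∞ F)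
    (hy : y ∈ (chartAt V p).target) (hm : F ((chartAt V p).symm y) ∈ (chartAt W m).source) :
    ContDiffAt ℝ ∞ (chartMap (W := W) V F p m) y := by
  refine contMDiffAt_iff_contDiffAt.1 ?_
  have h1 : ContMDiffAt 𝓘(ℝ, W) 𝓘(ℝ, W) ∞ (chartAt W m) (F ((chartAt V p).symm y)) :=
    contMDiffOn_chart.contMDiffAt ((chartAt W m).open_source.mem_nhds hm)
  exact h1.comp y (hF.contMDiffAt.comp y (contMDiffAt_chart_symm hy))

omit [IsManifold 𝓘(ℂ, W) ∞ N] [IsManifold 𝓘(ℝ, V) ∞ M] in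
theorem eventually_mem_source (hF : ContMDiff 𝓘(ℝ, V) 𝓘(ℝ, W) ∞ F)
    (hy : y ∈ (chartAt V p).target) (hm : F ((chartAt V p).symm y) ∈ (chartAt W m).source) :
    ∀ᶠ z in 𝓝 y, z ∈ (chartAt V p).target ∧ F ((chartAt V p).symm z) ∈ (chartAt W m).source := by
  have hc : ContinuousAt (F ∘ (chartAt V p).symm) y :=
    hF.continuous.continuousAt.comp ((chartAt V p).continuousAt_symm hy)
  exact (eventually_mem_chart_target hy).and
    (hc.eventually ((chartAt W m).open_source.mem_nhds hm))

/-- The chain rule for the two factorizations of `F ∘ (chartAt V p).symm`, one of them through the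
chart at `m`. -/
theorem differential_dSymm (hF : ContMDiff 𝓘(ℝ, V) 𝓘(ℝ, W) ∞ F)
    (hy : y ∈ (chartAt V p).target) (hm : F ((chartAt V p).symm y) ∈ (chartAt W m).source)
    (v : V) :
    differential W V F ((chartAt V p).symm y) (dSymm p y v)
      = dSymm m (chartMap (W := W) V F p m y) (fderiv ℝ (chartMap (W := W) V F p m) y v) := by
  have hm' : chartMap (W := W) V F p m y ∈ (chartAt W m).target := (chartAt W m).map_source hm
  have e1 := mfderiv_comp (I := 𝓘(ℝ, V)) (I' := 𝓘(ℝ, V)) (I'' := 𝓘(ℝ, W)) y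
    ((hF.contMDiffAt (x := (chartAt V p).symm y)).mdifferentiableAt (by simp))
    (mdifferentiableAt_chart_symm hy)
  have e2 := mfderiv_comp (I := 𝓘(ℝ, V)) (I' := 𝓘(ℝ, W)) (I'' := 𝓘(ℝ, W)) y
    (mdifferentiableAt_chart_symm hm')
    ((contDiffAt_chartMap hF hy hm).contMDiffAt.mdifferentiableAt (by simp))
  have e3 : F ∘ (chartAt V p).symm
      =ᶠ[𝓝 y] (chartAt W m).symm ∘ chartMap (W := W) V F p m := by
    filter_upwards [eventually_mem_source hF hy hm] with z hz
    exact ((chartAt W m).left_inv hz.2).symm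
  have e4 := congrArg (fun L : V →L[ℝ] W => L v) (e1.symm.trans (e3.mfderiv_eq.trans e2))
  refine e4.trans ?_
  exact congrArg (fun L : V →L[ℝ] W => dSymm m (chartMap (W := W) V F p m y) (L v))
    (mfderiv_eq_fderiv (f := chartMap (W := W) V F p m) (x := y))

theorem chartBilin_inducedMetric (h : HermitianMetric W N) (hF : ContMDiff 𝓘(ℝ, V) 𝓘(ℝ, W) ∞ F)
    (hy : y ∈ (chartAt V p).target) (hm : F ((chartAt V p).symm y) ∈ (chartAt W m).source)
    (u v : V) :
    chartBilin (inducedMetric V h F) p y u v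
      = chartBilin h.g m (chartMap (W := W) V F p m y) (fderiv ℝ (chartMap (W := W) V F p m) y u)
        (fderiv ℝ (chartMap (W := W) V F p m) y v) := by
  change h.g _ (differential W V F _ (dSymm p y u)) (differential W V F _ (dSymm p y v)) = _
  rw [differential_dSymm hF hy hm, differential_dSymm hF hy hm]
  simp [chartBilin, chartMap, (chartAt W m).left_inv hm]

theorem chartForm_pullbackForm (h : HermitianMetric W N) (hF : ContMDiff 𝓘(ℝ, V) 𝓘(ℝ, W) ∞ F)
    (hy : y ∈ (chartAt V p).target) (hm : F ((chartAt V p).symm y) ∈ (chartAt W m).source) :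
    chartForm (pullbackForm V h F) p y
      = (chartForm h.omega m (chartMap (W := W) V F p m y)).compContinuousLinearMap
        (fderiv ℝ (chartMap (W := W) V F p m) y) := by
  ext v
  change h.omega (F ((chartAt V p).symm y))
      (fun i => differential W V F ((chartAt V p).symm y) (dSymm p y (v i)))
    = h.omega ((chartAt W m).symm (chartMap (W := W) V F p m y))
      (fun i => dSymm m (chartMap (W := W) V F p m y) (fderiv ℝ (chartMap (W := W) V F p m) y (v i)))
  simp_rw [differential_dSymm hF hy hm]
  rw [show (chartAt W m).symm (chartMap (W := W) V F p m y) = F ((chartAt V p).symm y) from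
    (chartAt W m).left_inv hm]

variable [FiniteDimensional ℂ W] [FiniteDimensional ℝ V]

theorem contDiffAt_chartBilin_inducedMetric (h : HermitianMetric W N)
    (hF : ContMDiff 𝓘(ℝ, V) 𝓘(ℝ, W) ∞ F) (hy : y ∈ (chartAt V p).target) :
    ContDiffAt ℝ ∞ (chartBilin (inducedMetric V h F) p) y := by
  -- The chart of `N` is centred at the image of `y`, not at `F p`, because smoothness of the metric
  -- coefficients is available at the centre of a chart.
  set m := F ((chartAt V p).symm y) with hm_def
  have hm : F ((chartAt V p).symm y) ∈ (chartAt W m).source := mem_chart_source W m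
  have hΦ := contDiffAt_chartMap hF hy hm
  have hg : ContDiffAt ℝ ∞ (fun z => chartBilin h.g m (chartMap (W := W) V F p m z)) y :=
    ContDiffAt.comp (g := chartBilin h.g m) y (contDiffAt_chartBilin_metric h m) hΦ
  have hd : ContDiffAt ℝ ∞ (fderiv ℝ (chartMap (W := W) V F p m)) y :=
    hΦ.fderiv_right (by simp)
  refine contDiffAt_of_forall_apply fun u => contDiffAt_of_forall_apply fun v => ?_
  have hu : ContDiffAt ℝ ∞ (fun z => fderiv ℝ (chartMap (W := W) V F p m) z u) y :=
    hd.clm_apply contDiffAt_const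
  have hv : ContDiffAt ℝ ∞ (fun z => fderiv ℝ (chartMap (W := W) V F p m) z v) y :=
    hd.clm_apply contDiffAt_const
  refine ((hg.clm_apply hu).clm_apply hv).congr_of_eventuallyEq ?_
  filter_upwards [eventually_mem_source hF hy hm] with z hz
  exact chartBilin_inducedMetric h hF hz.1 hz.2 u v

/-- The bilinear form of `F^* ω` in a chart. -/
def chartPullback (V : Type*) [NormedAddCommGroup V] [NormedSpace ℝ V] [ChartedSpace V M]
    (h : HermitianMetric W N) (F : M → N) (p : M) (y : V) : V →L[ℝ] V →L[ℝ] ℝ :=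
  let L := differential W V F ((chartAt V p).symm y) ∘L dSymm p y
  (h.g (F ((chartAt V p).symm y))).bilinearComp (complexJ W ∘L L) L

omit [IsManifold 𝓘(ℝ, V) ∞ M] [FiniteDimensional ℂ W] [FiniteDimensional ℝ V] in
theorem chartPullback_apply (h : HermitianMetric W N) (u v : V) :
    chartPullback V h F p y u v = chartForm (pullbackForm V h F) p y ![u, v] := rfl

theorem contDiffAt_chartPullback (h : HermitianMetric W N)
    (hF : ContMDiff 𝓘(ℝ, V) 𝓘(ℝ, W) ∞ F) (hy : y ∈ (chartAt V p).target) :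
    ContDiffAt ℝ ∞ (chartPullback V h F p) y := by
  set m := F ((chartAt V p).symm y) with hm_def
  have hm : F ((chartAt V p).symm y) ∈ (chartAt W m).source := mem_chart_source W m
  have hΦ := contDiffAt_chartMap hF hy hm
  have hg : ContDiffAt ℝ ∞ (fun z => chartBilin h.g m (chartMap (W := W) V F p m z)) y :=
    ContDiffAt.comp (g := chartBilin h.g m) y (contDiffAt_chartBilin_metric h m) hΦ
  have hd : ContDiffAt ℝ ∞ (fderiv ℝ (chartMap (W := W) V F p m)) y :=
    hΦ.fderiv_right (by simp)
  refine contDiffAt_of_forall_apply fun u => contDiffAt_of_forall_apply fun v => ?_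
  have hu : ContDiffAt ℝ ∞ (fun z => fderiv ℝ (chartMap (W := W) V F p m) z u) y :=
    hd.clm_apply contDiffAt_const
  have hv : ContDiffAt ℝ ∞ (fun z => fderiv ℝ (chartMap (W := W) V F p m) z v) y :=
    hd.clm_apply contDiffAt_const
  refine ((hg.clm_apply ((complexJ W).contDiff.contDiffAt.comp y hu)).clm_apply
    hv).congr_of_eventuallyEq ?_
  filter_upwards [eventually_mem_source hF hy hm] with z hz
  rw [chartPullback_apply, chartForm_pullbackForm h hF hz.1 hz.2]
  refine Eq.trans ?_ (chartForm_omega h ((chartAt W m).map_source hz.2) _ _)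
  rw [ContinuousAlternatingMap.compContinuousLinearMap_apply]
  congr 1
  ext i
  fin_cases i <;> rfl

theorem contDiffAt_chartForm_pullbackForm (h : HermitianMetric W N)
    (hF : ContMDiff 𝓘(ℝ, V) 𝓘(ℝ, W) ∞ F) (hy : y ∈ (chartAt V p).target) :
    ContDiffAt ℝ ∞ (chartForm (pullbackForm V h F) p) y :=
  contDiffAt_form (contDiffAt_chartPullback h hF hy)
    (Eventually.of_forall fun _ _ _ => chartPullback_apply h _ _)

omit [FiniteDimensional ℝ V] in
theorem extDeriv_chartForm_pullbackForm (h : HermitianMetric W N) (hN : h.IsKahler)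
    (hF : ContMDiff 𝓘(ℝ, V) 𝓘(ℝ, W) ∞ F) (hy : y ∈ (chartAt V p).target) :
    extDeriv (chartForm (pullbackForm V h F) p) y = 0 := by
  set m := F ((chartAt V p).symm y) with hm_def
  have hm : F ((chartAt V p).symm y) ∈ (chartAt W m).source := mem_chart_source W m
  -- `IsKahler` gives `dω = 0` at chart centres; with `m` the image of `y`, this is what pulling
  -- back the exterior derivative at `y` requires.
  have hΦy : chartMap (W := W) V F p m y = chartAt W m m := rfl
  have h1 : chartForm (pullbackForm V h F) p
      =ᶠ[𝓝 y] fun z => (chartForm h.omega m (chartMap (W := W) V F p m z)).compContinuousLinearMap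
        (fderiv ℝ (chartMap (W := W) V F p m) z) := by
    filter_upwards [eventually_mem_source hF hy hm] with z hz
    exact chartForm_pullbackForm h hF hz.1 hz.2
  rw [h1.extDeriv_eq, extDeriv_pullback (r := ∞) _ (contDiffAt_chartMap hF hy hm)
      (by simpa using! (WithTop.coe_le_coe.2 le_top : ((2 : ℕ∞) : WithTop ℕ∞) ≤ ∞)), hΦy,
    show extDeriv (chartForm h.omega m) (chartAt W m m) = 0 from hN m]
  · rfl
  · rw [hΦy]
    exact (contDiffAt_chartForm_omega h m).differentiableAt (by simp)

end ImmersionCharts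

/-! ### Skew operators with equal angles: square, rank and polar decomposition. -/

section EqualAngles

variable {V : Type*} [NormedAddCommGroup V] [NormedSpace ℝ V]
  {B : V →L[ℝ] V →L[ℝ] ℝ} {A : V →L[ℝ] V}

theorem HasAngles.apply_apply {n : ℕ} {t : ℝ} (hA : HasAngles B A fun _ : Fin n => t) (v : V) :
    A (A v) = -((Real.cos t ^ 2) • v) := by
  obtain ⟨-, -, X, Y, -, hs, hX, hY⟩ := hA
  have key : (A.toLinearMap ∘ₗ A.toLinearMap) = -(Real.cos t ^ 2 • LinearMap.id) := by
    refine LinearMap.ext_on hs ?_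
    rintro _ ⟨i | i, rfl⟩
    · simp [hX, hY, smul_smul, pow_two]
    · simp [hX, hY, smul_smul, pow_two]
  exact congrArg (fun L : V →ₗ[ℝ] V => L v) key

theorem HasAngles.cos_nonneg {n : ℕ} (hn : 1 ≤ n) {t : ℝ}
    (hA : HasAngles B A fun _ : Fin n => t) : 0 ≤ Real.cos t :=
  Real.cos_nonneg_of_neg_pi_div_two_le_of_le
    (by linarith [(hA.2.1 ⟨0, hn⟩).1, Real.pi_pos]) (hA.2.1 ⟨0, hn⟩).2

/-- A skew-symmetric operator with square `-c²`, `c > 0`, has partial isometry `c⁻¹ A`. -/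
theorem polarIsometry_eq (pos : ∀ v, v ≠ 0 → 0 < B v v)
    (skew : ∀ v w, B (A v) w = -B (A w) v) {c : ℝ} (hc : 0 < c)
    (sq : ∀ v, A (A v) = -(c ^ 2 • v)) : polarIsometry B A = c⁻¹ • A := by
  have hex : ∃ J P, IsPolarDecomposition B A P J := by
    refine ⟨c⁻¹ • A, c • ContinuousLinearMap.id ℝ V, ⟨?_, ?_, ?_, ?_, ?_, ?_⟩⟩
    · intro u v
      simp
    · intro u
      rcases eq_or_ne u 0 with rfl | hu
      · simp
      · simpa using mul_nonneg hc.le (pos u hu).le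
    · intro u
      simp [sq, smul_smul, pow_two]
    · intro u
      simp [smul_smul, hc.ne']
    · intro u
      simp [hc.ne']
    · intro u _
      have : B (A u) (A u) = c ^ 2 * B u u := by
        rw [skew, sq]
        simp
      simp only [smul_apply, map_smul, this, smul_eq_mul]
      field_simp
  obtain ⟨P, hP⟩ := Classical.epsilon_spec hex
  -- Uniqueness of the square root: `(P + c)(P - c) = P² - c² = 0`, and `P + c` is injective because
  -- `P ≥ 0` and `c > 0`; hence `P = c`.
  have inj : ∀ u, P u + c • u = 0 → u = 0 := fun u hu => by
    by_contra hne
    have h1 : B (P u) u + c * B u u = 0 := by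
      simpa using congrArg (fun z => B z u) hu
    nlinarith [hP.nonneg u, mul_pos hc (pos u hne)]
  have hPc : ∀ u, P u = c • u := fun u => by
    refine sub_eq_zero.1 (inj _ ?_)
    rw [map_sub, map_smul, hP.sq, sq, smul_sub, smul_smul]
    simp [pow_two]
  ext u
  have h2 := hP.decomp u
  rw [hPc] at h2
  change (polarIsometry B A) u = c⁻¹ • A u
  rw [h2, smul_smul, inv_mul_cancel₀ hc.ne', one_smul]
  rfl

/-- If `c = 0`, then `B (A v) (A v) = -B (A (A v)) v = 0`, so `A = 0`, of rank `0 < 2n`; if `c ≠ 0`,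
then `A` is injective. -/
theorem finrank_range_eq_iff {n : ℕ} (hn : 1 ≤ n) [FiniteDimensional ℝ V]
    (hV : Module.finrank ℝ V = 2 * n) {c : ℝ}
    (pos : ∀ v, v ≠ 0 → 0 < B v v) (skew : ∀ v w, B (A v) w = -B (A w) v)
    (sq : ∀ v, A (A v) = -(c ^ 2 • v)) :
    Module.finrank ℝ (LinearMap.range A.toLinearMap) = 2 * n ↔ c ≠ 0 := by
  constructor
  · rintro h rfl
    have h0 : A = 0 := by
      ext v
      by_contra hv
      have h1 := pos _ hv
      rw [skew, sq] at h1
      simp at h1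
    rw [h0, ContinuousLinearMap.toLinearMap_zero, LinearMap.range_zero, finrank_bot] at h
    omega
  · intro hc
    have inj : Function.Injective A.toLinearMap := by
      refine (injective_iff_map_eq_zero _).2 fun v hv => ?_
      have h1 := sq v
      rw [show A v = 0 from hv, map_zero, eq_comm, neg_eq_zero] at h1
      exact (smul_eq_zero.1 h1).resolve_left (pow_ne_zero 2 hc)
    rw [LinearMap.finrank_range_of_inj inj, hV]

end EqualAngles

/-! ### Regularity of `cos²θ` and the description of `Ω⁰`. -/

section Immersion

open Filter

variable {W : Type*} [NormedAddCommGroup W] [NormedSpace ℂ W]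
  {N : Type*} [TopologicalSpace N] [ChartedSpace W N] [IsManifold 𝓘(ℂ, W) ∞ N]
  {V : Type*} [NormedAddCommGroup V] [NormedSpace ℝ V]
  {M : Type*} [TopologicalSpace M] [ChartedSpace V M]
  {F : M → N} {h : HermitianMetric W N}

theorem inducedMetric_symm (q : M) (u v : V) :
    inducedMetric V h F q u v = inducedMetric V h F q v u :=
  h.metric.symm _ _ _

theorem inducedMetric_pos (hF' : ∀ p, Function.Injective (mfderiv 𝓘(ℝ, V) 𝓘(ℝ, W) F p)) (q : M)
    (v : V) (hv : v ≠ 0) : 0 < inducedMetric V h F q v v := by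
  refine h.metric.pos (F q) (differential W V F q v) fun h0 => hv (hF' q ?_)
  exact h0.trans (map_zero (differential W V F q)).symm

theorem pullbackEnd_spec [FiniteDimensional ℝ V]
    (hF' : ∀ p, Function.Injective (mfderiv 𝓘(ℝ, V) 𝓘(ℝ, W) F p)) (q : M) (u v : V) :
    inducedMetric V h F q (pullbackEnd V h F q u) v = pullbackForm V h F q ![u, v] :=
  sharpEnd_spec _ (inducedMetric_pos hF' q) (LinearMap.mk₂ ℝ
    (fun u v => h.g (F q) (complexJ W (differential W V F q u)) (differential W V F q v))
    (fun _ _ _ => by simp) (fun _ _ _ => by simp) (fun _ _ _ => by simp)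
    (fun _ _ _ => by simp)) u v

theorem pullbackEnd_skew [FiniteDimensional ℝ V]
    (hF' : ∀ p, Function.Injective (mfderiv 𝓘(ℝ, V) 𝓘(ℝ, W) F p)) (q : M) (u v : V) :
    inducedMetric V h F q (pullbackEnd V h F q u) v
      = -inducedMetric V h F q (pullbackEnd V h F q v) u := by
  rw [pullbackEnd_spec hF', pullbackEnd_spec hF', form_swap]

variable [IsManifold 𝓘(ℝ, V) ∞ M] {p : M} {y : V}

omit [IsManifold 𝓘(ℝ, V) ∞ M] in
theorem chartBilin_apply (B : M → V →L[ℝ] V →L[ℝ] ℝ) (u v : V) :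
    chartBilin B p y u v = B ((chartAt V p).symm y) (dSymm p y u) (dSymm p y v) := rfl

omit [IsManifold 𝓘(ℝ, V) ∞ M] in
theorem chartEnd_apply (A : M → V →L[ℝ] V) (v : V) :
    chartEnd A p y v = dChart p y (A ((chartAt V p).symm y) (dSymm p y v)) := rfl

omit [IsManifold 𝓘(ℝ, V) ∞ M] in
theorem chartBilin_symm (u v : V) :
    chartBilin (inducedMetric V h F) p y u v = chartBilin (inducedMetric V h F) p y v u := by
  rw [chartBilin_apply, chartBilin_apply, inducedMetric_symm]

theorem chartBilin_pos (hF' : ∀ p, Function.Injective (mfderiv 𝓘(ℝ, V) 𝓘(ℝ, W) F p))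
    (hy : y ∈ (chartAt V p).target) (v : V) (hv : v ≠ 0) :
    0 < chartBilin (inducedMetric V h F) p y v v := by
  have hne : dSymm p y v ≠ 0 := fun h0 => hv <| by
    rw [← dChart_dSymm hy v, h0, ContinuousLinearMap.map_zero]
  rw [chartBilin_apply]
  exact inducedMetric_pos hF' ((chartAt V p).symm y) (dSymm p y v) hne

variable [FiniteDimensional ℝ V]

theorem chartBilin_chartEnd (hF' : ∀ p, Function.Injective (mfderiv 𝓘(ℝ, V) 𝓘(ℝ, W) F p))
    (hy : y ∈ (chartAt V p).target) (u v : V) :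
    chartBilin (inducedMetric V h F) p y (chartEnd (pullbackEnd V h F) p y u) v
      = chartPullback V h F p y u v := by
  rw [chartBilin_apply, chartEnd_apply, dSymm_dChart hy, pullbackEnd_spec hF']
  rfl

omit [FiniteDimensional ℝ V] in
theorem chartEnd_chartEnd {n : ℕ} {θ : M → ℝ} (hθ : HasEqualKahlerAngles V n h F θ)
    (hy : y ∈ (chartAt V p).target) (v : V) :
    chartEnd (pullbackEnd V h F) p y (chartEnd (pullbackEnd V h F) p y v)
      = -(Real.cos (θ ((chartAt V p).symm y)) ^ 2 • v) := by
  rw [chartEnd_apply, chartEnd_apply, dSymm_dChart hy, (hθ _).apply_apply, map_neg, map_smul, dChart_dSymm hy]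

variable [FiniteDimensional ℂ W]

theorem contDiffAt_chartEnd (hF : ContMDiff 𝓘(ℝ, V) 𝓘(ℝ, W) ∞ F)
    (hF' : ∀ p, Function.Injective (mfderiv 𝓘(ℝ, V) 𝓘(ℝ, W) F p))
    (hy : y ∈ (chartAt V p).target) :
    ContDiffAt ℝ ∞ (chartEnd (pullbackEnd V h F) p) y :=
  contDiffAt_of_dual (contDiffAt_chartBilin_inducedMetric h hF hy)
    ((eventually_mem_chart_target hy).mono fun _ hz => chartBilin_pos hF' hz)
    (contDiffAt_chartPullback h hF hy)
    ((eventually_mem_chart_target hy).mono fun _ hz => chartBilin_chartEnd hF' hz)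

/-- No regularity of `θ` is assumed; it comes from `cos²θ = -G(A²v, v) / G(v, v)` for any fixed `v ≠
0`. -/
theorem contDiffAt_cos_sq [Nontrivial V] {n : ℕ} {θ : M → ℝ}
    (hF : ContMDiff 𝓘(ℝ, V) 𝓘(ℝ, W) ∞ F)
    (hF' : ∀ p, Function.Injective (mfderiv 𝓘(ℝ, V) 𝓘(ℝ, W) F p))
    (hθ : HasEqualKahlerAngles V n h F θ) (hy : y ∈ (chartAt V p).target) :
    ContDiffAt ℝ ∞ (fun z => Real.cos (θ ((chartAt V p).symm z)) ^ 2) y := by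
  obtain ⟨v, hv⟩ := exists_ne (0 : V)
  have hG := contDiffAt_chartBilin_inducedMetric h hF hy
  have hA := contDiffAt_chartEnd (h := h) hF hF' hy
  have hc : ContDiffAt ℝ ∞ (fun _ : V => v) y := contDiffAt_const
  refine (((hG.clm_apply (hA.clm_apply (hA.clm_apply hc))).clm_apply hc).neg.div
    ((hG.clm_apply hc).clm_apply hc) (chartBilin_pos hF' hy v hv).ne').congr_of_eventuallyEq ?_
  filter_upwards [eventually_mem_chart_target hy] with z hz
  have h1 := chartBilin_pos (h := h) hF' hz v hv
  rw [Pi.div_apply, chartEnd_chartEnd hθ hz, eq_div_iff h1.ne']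
  simp

theorem continuous_cos_sq [Nontrivial V] {n : ℕ} {θ : M → ℝ}
    (hF : ContMDiff 𝓘(ℝ, V) 𝓘(ℝ, W) ∞ F)
    (hF' : ∀ p, Function.Injective (mfderiv 𝓘(ℝ, V) 𝓘(ℝ, W) F p))
    (hθ : HasEqualKahlerAngles V n h F θ) : Continuous fun q => Real.cos (θ q) ^ 2 :=
  continuous_iff_continuousAt.2 fun p =>
    (contMDiffAt_iff_contDiffAt_chart.2
      (contDiffAt_cos_sq hF hF' hθ (chart_self_mem_target p))).continuousAt

/-- The full-rank set is where `cos²θ ≠ 0`, which is already open by continuity, so taking the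
interior changes nothing. -/
theorem mem_constantRankSet [Nontrivial V] {n : ℕ} (hn : 1 ≤ n)
    (hV : Module.finrank ℝ V = 2 * n) {θ : M → ℝ} (hF : ContMDiff 𝓘(ℝ, V) 𝓘(ℝ, W) ∞ F)
    (hF' : ∀ p, Function.Injective (mfderiv 𝓘(ℝ, V) 𝓘(ℝ, W) F p))
    (hθ : HasEqualKahlerAngles V n h F θ) :
    p ∈ constantRankSet V h F n ↔ Real.cos (θ p) ≠ 0 := by
  have h1 : {p | Module.finrank ℝ (LinearMap.range (pullbackEnd V h F p).toLinearMap) = 2 * n}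
      = {p | Real.cos (θ p) ≠ 0} := by
    ext q
    exact finrank_range_eq_iff hn hV (inducedMetric_pos hF' q) (pullbackEnd_skew hF' q)
      (hθ q).apply_apply
  have h2 : IsOpen {p | Real.cos (θ p) ≠ 0} := by
    have := (continuous_cos_sq hF hF' hθ).isOpen_preimage {0}ᶜ isOpen_compl_singleton
    convert this using 1
    ext q
    simp
  rw [constantRankSet, h1, h2.interior_eq]
  rfl

omit [IsManifold 𝓘(ℝ, V) ∞ M] [FiniteDimensional ℂ W] in
theorem Jomega_eq {n : ℕ} (hn : 1 ≤ n) {θ : M → ℝ}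
    (hF' : ∀ p, Function.Injective (mfderiv 𝓘(ℝ, V) 𝓘(ℝ, W) F p))
    (hθ : HasEqualKahlerAngles V n h F θ) (hp : Real.cos (θ p) ≠ 0) :
    Jomega V h F p = (Real.cos (θ p))⁻¹ • pullbackEnd V h F p :=
  polarIsometry_eq (inducedMetric_pos hF' p) (pullbackEnd_skew hF' p)
    (lt_of_le_of_ne ((hθ p).cos_nonneg hn) hp.symm) (hθ p).apply_apply

end Immersion

/-! ### The divergence formulas and local constancy of the angle. -/

section Divergence

open Filter

variable {W : Type*} [NormedAddCommGroup W] [NormedSpace ℂ W] [FiniteDimensional ℂ W]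
  {N : Type*} [TopologicalSpace N] [ChartedSpace W N] [IsManifold 𝓘(ℂ, W) ∞ N]
  {V : Type*} [NormedAddCommGroup V] [NormedSpace ℝ V] [FiniteDimensional ℝ V]
  {M : Type*} [TopologicalSpace M] [ChartedSpace V M] [IsManifold 𝓘(ℝ, V) ∞ M]
  {F : M → N} {h : HermitianMetric W N} {p : M} {y : V}

theorem deltaForm_pullbackForm_apply (hF : ContMDiff 𝓘(ℝ, V) 𝓘(ℝ, W) ∞ F)
    (hF' : ∀ p, Function.Injective (mfderiv 𝓘(ℝ, V) 𝓘(ℝ, W) F p)) (p : M) (v : V) :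
    deltaForm (inducedMetric V h F) (pullbackForm V h F) p ![v] =
      inducedMetric V h F p (deltaEnd (inducedMetric V h F) (pullbackEnd V h F) p) v := by
  have hx := chart_self_mem_target (V := V) p
  have key := coordDeltaForm_apply (A := chartEnd (pullbackEnd V h F) p)
    ((contDiffAt_chartBilin_inducedMetric h hF hx).differentiableAt (by simp))
    (chartBilin_pos hF' hx) (Eventually.of_forall fun _ => chartBilin_symm)
    ((contDiffAt_chartEnd hF hF' hx).differentiableAt (by simp))
    ((contDiffAt_chartForm_pullbackForm h hF hx).differentiableAt (by simp))
    ((eventually_mem_chart_target hx).mono fun _ hz => chartBilin_chartEnd hF' hz) v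
  rw [chartBilin_self] at key
  exact key

theorem deltaForm_pullbackForm_eq_zero_iff (hF : ContMDiff 𝓘(ℝ, V) 𝓘(ℝ, W) ∞ F)
    (hF' : ∀ p, Function.Injective (mfderiv 𝓘(ℝ, V) 𝓘(ℝ, W) F p)) (p : M) :
    deltaForm (inducedMetric V h F) (pullbackForm V h F) p = 0 ↔
      deltaEnd (inducedMetric V h F) (pullbackEnd V h F) p = 0 := by
  constructor
  · intro h0
    refine eq_of_forall_apply_eq (inducedMetric_pos (h := h) hF' p) fun v => ?_
    rw [← deltaForm_pullbackForm_apply hF hF', h0]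
    simp
  · intro h0
    ext v
    obtain ⟨a, rfl⟩ : ∃ a, v = ![a] := ⟨v 0, by ext i; fin_cases i; rfl⟩
    rw [deltaForm_pullbackForm_apply hF hF', h0]
    simp

omit [FiniteDimensional ℝ V] in
theorem hodgeLaplacian_pullbackForm (hN : h.IsKahler) (hF : ContMDiff 𝓘(ℝ, V) 𝓘(ℝ, W) ∞ F)
    (h0 : ∀ p, deltaForm (inducedMetric V h F) (pullbackForm V h F) p = 0) (p : M) :
    hodgeLaplacian (inducedMetric V h F) (pullbackForm V h F) p = 0 := by
  have e1 : deltaForm (inducedMetric V h F) (pullbackForm V h F) = fun _ => 0 := funext h0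
  have e2 : extD (pullbackForm V h F) = fun _ => 0 := funext fun q =>
    extDeriv_chartForm_pullbackForm h hN hF (chart_self_mem_target q)
  have e3 : ∀ k, chartForm (fun _ : M => (0 : V [⋀^Fin k]→L[ℝ] ℝ)) p = fun _ => 0 := fun k => by
    ext y v
    rfl
  rw [hodgeLaplacian, e1, e2, extD, deltaForm, e3, e3]
  have e4 : extDeriv (fun _ : V => (0 : V [⋀^Fin 1]→L[ℝ] ℝ)) (chartAt V p p) = 0 := by
    have := extDeriv_smul (0 : ℝ) (fun _ : V => (0 : V [⋀^Fin 1]→L[ℝ] ℝ)) (x := chartAt V p p)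
    simpa using! this
  have e5 : ∀ u, covForm (chartBilin (inducedMetric V h F) p)
      (fun _ : V => (0 : V [⋀^Fin 3]→L[ℝ] ℝ)) (chartAt V p p) u = 0 := fun u => by
    ext v
    rw [covForm, fderiv_const_apply, ContinuousAlternatingMap.sub_apply, derivation_apply]
    simp
  rw [e4, coordDeltaForm]
  simp [e5]

variable {n : ℕ} {θ : M → ℝ}

/-- Stated for `cos²θ`, which is smooth everywhere, so that it needs no condition `cos θ ≠ 0`; the
coefficient is `1 - dim/4` with `dim = 2n`. -/
theorem apply_coordDeltaEnd_pullbackEnd [Nontrivial V] (hV : Module.finrank ℝ V = 2 * n)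
    (hN : h.IsKahler) (hF : ContMDiff 𝓘(ℝ, V) 𝓘(ℝ, W) ∞ F)
    (hF' : ∀ p, Function.Injective (mfderiv 𝓘(ℝ, V) 𝓘(ℝ, W) F p))
    (hθ : HasEqualKahlerAngles V n h F θ) (hy : y ∈ (chartAt V p).target) (w : V) :
    chartBilin (inducedMetric V h F) p y (chartEnd (pullbackEnd V h F) p y
      (coordDeltaEnd (chartBilin (inducedMetric V h F) p) (chartEnd (pullbackEnd V h F) p) y)) w
      = (1 - (n : ℝ) / 2) * fderiv ℝ (fun z => Real.cos (θ ((chartAt V p).symm z)) ^ 2) y w := by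
  have key := apply_coordDeltaEnd (A := chartEnd (pullbackEnd V h F) p)
    ((contDiffAt_cos_sq hF hF' hθ hy).differentiableAt (by simp))
    ((contDiffAt_chartBilin_inducedMetric h hF hy).differentiableAt (by simp))
    (chartBilin_pos hF' hy) (Eventually.of_forall fun _ => chartBilin_symm)
    ((contDiffAt_chartEnd hF hF' hy).differentiableAt (by simp))
    ((contDiffAt_chartForm_pullbackForm h hF hy).differentiableAt (by simp))
    ((eventually_mem_chart_target hy).mono fun _ hz => chartBilin_chartEnd hF' hz)
    (extDeriv_chartForm_pullbackForm h hN hF hy)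
    ((eventually_mem_chart_target hy).mono fun _ hz => chartEnd_chartEnd hθ hz) w
  rw [key, hV]
  push_cast
  ring

/-- If `F^* ω` is co-closed where it does not vanish, for the reason that the right-hand side of
the divergence formula vanishes there, then it is co-closed. -/
theorem deltaEnd_pullbackEnd_eq_zero [Nontrivial V] (hV : Module.finrank ℝ V = 2 * n)
    (hN : h.IsKahler) (hF : ContMDiff 𝓘(ℝ, V) 𝓘(ℝ, W) ∞ F)
    (hF' : ∀ p, Function.Injective (mfderiv 𝓘(ℝ, V) 𝓘(ℝ, W) F p))
    (hθ : HasEqualKahlerAngles V n h F θ)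
    (h0 : ∀ y ∈ (chartAt V p).target, Real.cos (θ ((chartAt V p).symm y)) ≠ 0 →
      (1 - (n : ℝ) / 2) • fderiv ℝ (fun z => Real.cos (θ ((chartAt V p).symm z)) ^ 2) y = 0) :
    deltaEnd (inducedMetric V h F) (pullbackEnd V h F) p = 0 := by
  have hx := chart_self_mem_target (V := V) p
  refine coordDeltaEnd_eq_zero_of_ne_zero
    ((contDiffAt_chartBilin_inducedMetric h hF hx).of_le (by simp))
    ((contDiffAt_chartEnd hF hF' hx).of_le (by simp))
    ((eventually_mem_chart_target hx).mono fun _ hz => chartBilin_pos hF' hz)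
    (Eventually.of_forall fun _ => chartBilin_symm) ?_
  filter_upwards [eventually_mem_chart_target hx] with y hy hA
  -- Where `cos θ = 0`, `A² = 0`, and a skew operator with zero square is zero.
  have hc : Real.cos (θ ((chartAt V p).symm y)) ≠ 0 := fun hc => hA <| by
    ext v
    by_contra hv
    have h1 := chartBilin_pos (h := h) hF' hy _ hv
    rw [chartBilin_chartEnd hF' hy, chartPullback_apply, form_swap, ← chartPullback_apply,
      ← chartBilin_chartEnd hF' hy, chartEnd_chartEnd hθ hy, hc] at h1
    simp at h1
  have h1 : chartEnd (pullbackEnd V h F) p y (coordDeltaEnd (chartBilin (inducedMetric V h F) p)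
      (chartEnd (pullbackEnd V h F) p) y) = 0 := by
    refine eq_of_forall_apply_eq (chartBilin_pos (h := h) hF' hy) fun w => ?_
    rw [apply_coordDeltaEnd_pullbackEnd hV hN hF hF' hθ hy w]
    simpa using congrArg (fun L : V →L[ℝ] ℝ => L w) (h0 y hy hc)
  -- `A δA = 0` implies `cos²θ δA = 0`.
  have h2 := chartEnd_chartEnd hθ hy (coordDeltaEnd (chartBilin (inducedMetric V h F) p)
      (chartEnd (pullbackEnd V h F) p) y)
  rw [h1, ContinuousLinearMap.map_zero, eq_comm, neg_eq_zero] at h2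
  exact (smul_eq_zero.1 h2).resolve_left (pow_ne_zero 2 hc)

theorem eventually_cos_ne_zero [Nontrivial V] (hF : ContMDiff 𝓘(ℝ, V) 𝓘(ℝ, W) ∞ F)
    (hF' : ∀ p, Function.Injective (mfderiv 𝓘(ℝ, V) 𝓘(ℝ, W) F p))
    (hθ : HasEqualKahlerAngles V n h F θ) (hp : Real.cos (θ p) ≠ 0) :
    ∀ᶠ y in 𝓝 (chartAt V p p), y ∈ (chartAt V p).target ∧
      Real.cos (θ ((chartAt V p).symm y)) ≠ 0 := by
  have hx := chart_self_mem_target (V := V) p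
  have hc : Real.cos (θ ((chartAt V p).symm (chartAt V p p))) ^ 2 ≠ 0 := by
    rw [chart_symm_self]
    exact pow_ne_zero 2 hp
  filter_upwards [eventually_mem_chart_target hx,
    (contDiffAt_cos_sq hF hF' hθ hx).continuousAt.eventually_ne hc] with y hy hy'
  exact ⟨hy, fun h0 => hy' (by simp [h0])⟩

/-- `cos θ ≥ 0`, so it is the square root of the smooth function `cos²θ`, nonzero here. -/
theorem contDiffAt_cos [Nontrivial V] (hn : 1 ≤ n) (hF : ContMDiff 𝓘(ℝ, V) 𝓘(ℝ, W) ∞ F)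
    (hF' : ∀ p, Function.Injective (mfderiv 𝓘(ℝ, V) 𝓘(ℝ, W) F p))
    (hθ : HasEqualKahlerAngles V n h F θ) (hy : y ∈ (chartAt V p).target)
    (hc : Real.cos (θ ((chartAt V p).symm y)) ≠ 0) :
    ContDiffAt ℝ ∞ (fun z => Real.cos (θ ((chartAt V p).symm z))) y := by
  refine ((contDiffAt_cos_sq hF hF' hθ hy).sqrt (pow_ne_zero 2 hc)).congr_of_eventuallyEq ?_
  exact Eventually.of_forall fun z => (Real.sqrt_sq ((hθ _).cos_nonneg hn)).symm

theorem chartEnd_Jomega_eventuallyEq [Nontrivial V] (hn : 1 ≤ n)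
    (hF : ContMDiff 𝓘(ℝ, V) 𝓘(ℝ, W) ∞ F)
    (hF' : ∀ p, Function.Injective (mfderiv 𝓘(ℝ, V) 𝓘(ℝ, W) F p))
    (hθ : HasEqualKahlerAngles V n h F θ) (hp : Real.cos (θ p) ≠ 0) :
    chartEnd (Jomega V h F) p =ᶠ[𝓝 (chartAt V p p)] fun y =>
      (Real.cos (θ ((chartAt V p).symm y)))⁻¹ • chartEnd (pullbackEnd V h F) p y := by
  filter_upwards [eventually_cos_ne_zero hF hF' hθ hp] with y hy
  ext v
  rw [chartEnd_apply, Jomega_eq hn hF' hθ hy.2, smul_apply, smul_apply, chartEnd_apply,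
    ContinuousLinearMap.map_smul]

theorem contDiffAt_chartEnd_Jomega [Nontrivial V] (hn : 1 ≤ n)
    (hF : ContMDiff 𝓘(ℝ, V) 𝓘(ℝ, W) ∞ F)
    (hF' : ∀ p, Function.Injective (mfderiv 𝓘(ℝ, V) 𝓘(ℝ, W) F p))
    (hθ : HasEqualKahlerAngles V n h F θ) (hp : Real.cos (θ p) ≠ 0) :
    ContDiffAt ℝ ∞ (chartEnd (Jomega V h F) p) (chartAt V p p) := by
  have hx := chart_self_mem_target (V := V) p
  have hc : Real.cos (θ ((chartAt V p).symm (chartAt V p p))) ≠ 0 := by rwa [chart_symm_self]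
  exact (((contDiffAt_cos hn hF hF' hθ hx hc).inv hc).smul
    (contDiffAt_chartEnd hF hF' hx)).congr_of_eventuallyEq
    (chartEnd_Jomega_eventuallyEq hn hF hF' hθ hp)

theorem contMDiffAt_cos [Nontrivial V] (hn : 1 ≤ n) (hF : ContMDiff 𝓘(ℝ, V) 𝓘(ℝ, W) ∞ F)
    (hF' : ∀ p, Function.Injective (mfderiv 𝓘(ℝ, V) 𝓘(ℝ, W) F p))
    (hθ : HasEqualKahlerAngles V n h F θ) (hp : Real.cos (θ p) ≠ 0) :
    ContMDiffAt 𝓘(ℝ, V) 𝓘(ℝ, ℝ) ∞ (fun q => Real.cos (θ q)) p :=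
  contMDiffAt_iff_contDiffAt_chart.2 (contDiffAt_cos hn hF hF' hθ (chart_self_mem_target p)
    (by rwa [chart_symm_self]))

theorem gradient_cos [Nontrivial V] (hn : 1 ≤ n) (hF : ContMDiff 𝓘(ℝ, V) 𝓘(ℝ, W) ∞ F)
    (hF' : ∀ p, Function.Injective (mfderiv 𝓘(ℝ, V) 𝓘(ℝ, W) F p))
    (hθ : HasEqualKahlerAngles V n h F θ) (hp : Real.cos (θ p) ≠ 0) :
    gradient (inducedMetric V h F) (fun q => Real.cos (θ q)) p
      = sharp (inducedMetric V h F p)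
        (fderiv ℝ (fun z => Real.cos (θ ((chartAt V p).symm z))) (chartAt V p p)) := by
  rw [gradient, mfderiv_eq_fderiv_chart
    ((contMDiffAt_cos hn hF hF' hθ hp).mdifferentiableAt (by simp))]
  rfl

omit [FiniteDimensional ℂ W] [IsManifold 𝓘(ℝ, V) ∞ M] in
theorem Jomega_Jomega (hn : 1 ≤ n)
    (hF' : ∀ p, Function.Injective (mfderiv 𝓘(ℝ, V) 𝓘(ℝ, W) F p))
    (hθ : HasEqualKahlerAngles V n h F θ) (hp : Real.cos (θ p) ≠ 0) (v : V) :
    Jomega V h F p (Jomega V h F p v) = -v := by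
  rw [Jomega_eq hn hF' hθ hp]
  simp only [smul_apply, map_smul, (hθ p).apply_apply, smul_neg, smul_smul]
  rw [show (Real.cos (θ p))⁻¹ * ((Real.cos (θ p))⁻¹ * Real.cos (θ p) ^ 2) = 1 by field_simp,
    one_smul]

theorem deltaEnd_pullbackEnd [Nontrivial V] (hn : 1 ≤ n) (hV : Module.finrank ℝ V = 2 * n)
    (hN : h.IsKahler) (hF : ContMDiff 𝓘(ℝ, V) 𝓘(ℝ, W) ∞ F)
    (hF' : ∀ p, Function.Injective (mfderiv 𝓘(ℝ, V) 𝓘(ℝ, W) F p))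
    (hθ : HasEqualKahlerAngles V n h F θ) (hp : Real.cos (θ p) ≠ 0) :
    deltaEnd (inducedMetric V h F) (pullbackEnd V h F) p =
      ((n : ℝ) - 2) •
        Jomega V h F p (gradient (inducedMetric V h F) (fun q => Real.cos (θ q)) p) := by
  have hx := chart_self_mem_target (V := V) p
  have hc : Real.cos (θ ((chartAt V p).symm (chartAt V p p))) ≠ 0 := by rwa [chart_symm_self]
  have hC := (contDiffAt_cos hn hF hF' hθ hx hc).differentiableAt (by simp)
  set δ := deltaEnd (inducedMetric V h F) (pullbackEnd V h F) p with hδ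
  set X := gradient (inducedMetric V h F) (fun q => Real.cos (θ q)) p with hX
  set c := Real.cos (θ p) with hcdef
  have hgrad : ∀ w, inducedMetric V h F p X w
      = fderiv ℝ (fun z => Real.cos (θ ((chartAt V p).symm z))) (chartAt V p p) w := fun w => by
    rw [hX, gradient_cos hn hF hF' hθ hp]
    exact sharp_spec _ (inducedMetric_pos hF' p)
      (fderiv ℝ (fun z => Real.cos (θ ((chartAt V p).symm z))) (chartAt V p p)).toLinearMap w
  -- Here `(1 - n/2) d(cos²θ) = (2 - n) cos θ d(cos θ)`.
  have h1 : pullbackEnd V h F p δ = ((2 - n) * c) • X := by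
    refine eq_of_forall_apply_eq (inducedMetric_pos (h := h) hF' p) fun w => ?_
    have key := apply_coordDeltaEnd_pullbackEnd hV hN hF hF' hθ hx w
    rw [chartBilin_self, chartEnd_self, fderiv_fun_pow 2 hC, chart_symm_self] at key
    refine key.trans ?_
    rw [map_smul, smul_apply, smul_apply, hgrad, smul_eq_mul]
    simp
    ring
  have h2 := (hθ p).apply_apply δ
  rw [h1, map_smul, ← hcdef] at h2
  -- Apply `A` to `h1`: the left side becomes `-c² δ`, and `A = c J_ω` on the right supplies the
  -- second factor `c`.
  have h3 : (c ^ 2) • δ = (c ^ 2) • (((n : ℝ) - 2) • Jomega V h F p X) := by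
    rw [Jomega_eq hn hF' hθ hp, ← neg_eq_iff_eq_neg.2 h2, smul_apply, ← hcdef, smul_smul, smul_smul,
      ← neg_smul]
    congr 1
    field_simp
    ring
  exact smul_right_injective V (pow_ne_zero 2 hp) h3

/-- The Leibniz rule for `A = cos θ J_ω` adds one `J_ω (∇ cos θ)` to `δA`, turning `n - 2` into `n -
1`. -/
theorem cos_smul_deltaEnd_Jomega [Nontrivial V] (hn : 1 ≤ n) (hV : Module.finrank ℝ V = 2 * n)
    (hN : h.IsKahler) (hF : ContMDiff 𝓘(ℝ, V) 𝓘(ℝ, W) ∞ F)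
    (hF' : ∀ p, Function.Injective (mfderiv 𝓘(ℝ, V) 𝓘(ℝ, W) F p))
    (hθ : HasEqualKahlerAngles V n h F θ) (hp : Real.cos (θ p) ≠ 0) :
    Real.cos (θ p) • deltaEnd (inducedMetric V h F) (Jomega V h F) p =
      ((n : ℝ) - 1) •
        Jomega V h F p (gradient (inducedMetric V h F) (fun q => Real.cos (θ q)) p) := by
  have hx := chart_self_mem_target (V := V) p
  have hc : Real.cos (θ ((chartAt V p).symm (chartAt V p p))) ≠ 0 := by rwa [chart_symm_self]
  have h1 : chartEnd (pullbackEnd V h F) p =ᶠ[𝓝 (chartAt V p p)] fun y =>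
      Real.cos (θ ((chartAt V p).symm y)) • chartEnd (Jomega V h F) p y := by
    filter_upwards [chartEnd_Jomega_eventuallyEq hn hF hF' hθ hp,
      eventually_cos_ne_zero hF hF' hθ hp] with y hy hy'
    rw [hy, smul_smul, mul_inv_cancel₀ hy'.2, one_smul]
  have h2 := coordDeltaEnd_smul (G := chartBilin (inducedMetric V h F) p)
    ((contDiffAt_cos hn hF hF' hθ hx hc).differentiableAt (by simp))
    ((contDiffAt_chartEnd_Jomega hn hF hF' hθ hp).differentiableAt (by simp))
    chartBilin_symm (chartBilin_pos hF' hx)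
  rw [← coordDeltaEnd_congr h1, chartBilin_self, chartEnd_self, chart_symm_self,
    ← gradient_cos hn hF hF' hθ hp] at h2
  have h3 : deltaEnd (inducedMetric V h F) (pullbackEnd V h F) p
      = Real.cos (θ p) • deltaEnd (inducedMetric V h F) (Jomega V h F) p
        - Jomega V h F p (gradient (inducedMetric V h F) (fun q => Real.cos (θ q)) p) := h2
  rw [deltaEnd_pullbackEnd hn hV hN hF hF' hθ hp, eq_sub_iff_add_eq] at h3
  rw [← h3]
  module

omit [IsManifold 𝓘(ℝ, V) ∞ M] in
theorem gradient_eq_zero_of_eventuallyEq {B : M → V →L[ℝ] V →L[ℝ] ℝ}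
    (pos : ∀ v, v ≠ 0 → 0 < B p v v) {f : M → ℝ} (hf : ∀ᶠ q in 𝓝 p, f q = f p) :
    gradient B f p = 0 := by
  have h1 : mfderiv 𝓘(ℝ, V) 𝓘(ℝ, ℝ) f p = 0 := by
    have : f =ᶠ[𝓝 p] fun _ => f p := hf
    rw [this.mfderiv_eq]
    exact mfderiv_const
  refine eq_of_forall_apply_eq pos fun w => ?_
  refine (sharp_spec (B p) pos (0 : V →L[ℝ] ℝ).toLinearMap w |> fun h2 => ?_)
  rw [gradient, h1]
  refine h2.trans ?_
  simp

omit [FiniteDimensional ℂ W] [FiniteDimensional ℝ V] [IsManifold 𝓘(ℝ, V) ∞ M] in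
theorem kahlerAngle_eq_of_cos_eq (hn : 1 ≤ n) (hθ : HasEqualKahlerAngles V n h F θ)
    {q : M} (hq : Real.cos (θ q) = Real.cos (θ p)) : θ q = θ p := by
  have hm : ∀ r, θ r ∈ Set.Icc 0 Real.pi := fun r =>
    ⟨((hθ r).2.1 ⟨0, hn⟩).1, ((hθ r).2.1 ⟨0, hn⟩).2.trans (by linarith [Real.pi_pos])⟩
  exact Real.injOn_cos (hm q) (hm p) hq

theorem gradient_cos_eq_zero_iff [Nontrivial V] (hn : 1 ≤ n)
    (hF : ContMDiff 𝓘(ℝ, V) 𝓘(ℝ, W) ∞ F)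
    (hF' : ∀ p, Function.Injective (mfderiv 𝓘(ℝ, V) 𝓘(ℝ, W) F p))
    (hθ : HasEqualKahlerAngles V n h F θ) :
    (∀ p, Real.cos (θ p) ≠ 0 →
      gradient (inducedMetric V h F) (fun q => Real.cos (θ q)) p = 0) ↔
    ∀ p, Real.cos (θ p) ≠ 0 → ∀ᶠ q in 𝓝 p, θ q = θ p := by
  constructor
  · intro h0 p hp
    have hd : ∀ q, Real.cos (θ q) ≠ 0 →
        (mfderiv 𝓘(ℝ, V) 𝓘(ℝ, ℝ) (fun q => Real.cos (θ q)) q : V →L[ℝ] ℝ) = 0 := fun q hq => by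
      ext w
      refine (sharp_spec (inducedMetric V h F q) (inducedMetric_pos hF' q)
        (mfderiv 𝓘(ℝ, V) 𝓘(ℝ, ℝ) (fun q => Real.cos (θ q)) q : V →L[ℝ] ℝ).toLinearMap w).symm.trans
        ?_
      have := h0 q hq
      rw [gradient] at this
      refine (congrArg (fun z => inducedMetric V h F q z w) this).trans ?_
      exact congrArg (fun L : V →L[ℝ] ℝ => L w) (inducedMetric V h F q).map_zero
    have hx := chart_self_mem_target (V := V) p
    -- On a coordinate ball where `cos θ ≠ 0` the derivative of `cos θ` vanishes identically, so
    -- `cos θ` is constant on it, and `cos` is injective on `[0, π]`.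
    obtain ⟨ε, hε, hb⟩ := Metric.eventually_nhds_iff_ball.1 (eventually_cos_ne_zero hF hF' hθ hp)
    have hderiv : ∀ y ∈ Metric.ball (chartAt V p p) ε,
        fderiv ℝ (fun z => Real.cos (θ ((chartAt V p).symm z))) y = 0 := fun y hy => by
      have e1 := mfderiv_comp (I := 𝓘(ℝ, V)) (I' := 𝓘(ℝ, V)) (I'' := 𝓘(ℝ, ℝ)) y
        ((contMDiffAt_cos hn hF hF' hθ (hb y hy).2).mdifferentiableAt (by simp))
        (mdifferentiableAt_chart_symm (hb y hy).1)
      rw [mfderiv_eq_fderiv] at e1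
      refine e1.trans ?_
      ext w
      exact congrArg (fun L : V →L[ℝ] ℝ => L (dSymm p y w)) (hd _ (hb y hy).2)
    have hconst : ∀ y ∈ Metric.ball (chartAt V p p) ε,
        Real.cos (θ ((chartAt V p).symm y)) = Real.cos (θ p) := fun y hy => by
      have := Metric.isOpen_ball.is_const_of_fderiv_eq_zero
        (convex_ball (chartAt V p p) ε).isPreconnected
        (fun z hz => ((contDiffAt_cos hn hF hF' hθ (hb z hz).1
          (hb z hz).2).differentiableAt (by simp)).differentiableWithinAt)
        hderiv hy (Metric.mem_ball_self hε)
      rwa [chart_symm_self] at this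
    filter_upwards [(chartAt V p).open_source.mem_nhds (mem_chart_source V p),
      ((chartAt V p).continuousAt (mem_chart_source V p)).eventually
        (Metric.ball_mem_nhds _ hε)] with q hq hq'
    have := hconst _ hq'
    rw [(chartAt V p).left_inv hq] at this
    exact kahlerAngle_eq_of_cos_eq hn hθ this
  · intro h0 p hp
    exact gradient_eq_zero_of_eventuallyEq (inducedMetric_pos hF' p)
      ((h0 p hp).mono fun q hq => by rw [hq])

/-- The conclusion also covers points with `cos θ = 0`, where `θ` is not assumed locally constant;
they are reached through `deltaEnd_pullbackEnd_eq_zero`. -/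
theorem deltaEnd_pullbackEnd_eq_zero_of_locallyConstant [Nontrivial V]
    (hV : Module.finrank ℝ V = 2 * n) (hN : h.IsKahler) (hF : ContMDiff 𝓘(ℝ, V) 𝓘(ℝ, W) ∞ F)
    (hF' : ∀ p, Function.Injective (mfderiv 𝓘(ℝ, V) 𝓘(ℝ, W) F p))
    (hθ : HasEqualKahlerAngles V n h F θ)
    (h0 : ∀ p, Real.cos (θ p) ≠ 0 → ∀ᶠ q in 𝓝 p, θ q = θ p) (p : M) :
    deltaEnd (inducedMetric V h F) (pullbackEnd V h F) p = 0 := by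
  refine deltaEnd_pullbackEnd_eq_zero hV hN hF hF' hθ fun y hy hc => ?_
  have h1 : (fun z => Real.cos (θ ((chartAt V p).symm z)) ^ 2)
      =ᶠ[𝓝 y] fun _ => Real.cos (θ ((chartAt V p).symm y)) ^ 2 := by
    filter_upwards [((chartAt V p).continuousAt_symm hy).eventually (h0 _ hc)] with z hz
    rw [hz]
  rw [h1.fderiv_eq, fderiv_const_apply, smul_zero]

theorem locallyConstant_iff_constant [Nontrivial V] (hn : 1 ≤ n)
    (hF : ContMDiff 𝓘(ℝ, V) 𝓘(ℝ, W) ∞ F)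
    (hF' : ∀ p, Function.Injective (mfderiv 𝓘(ℝ, V) 𝓘(ℝ, W) F p))
    (hθ : HasEqualKahlerAngles V n h F θ) [PreconnectedSpace M] :
    (∀ p, Real.cos (θ p) ≠ 0 → ∀ᶠ q in 𝓝 p, θ q = θ p) ↔ ∃ c, ∀ p, θ p = c := by
  constructor
  · intro h0
    by_cases hex : ∃ p, Real.cos (θ p) ≠ 0
    · obtain ⟨p, hp⟩ := hex
      have hsq : ∀ q r, Real.cos (θ q) ^ 2 = Real.cos (θ r) ^ 2 → θ q = θ r := fun q r hqr =>
        kahlerAngle_eq_of_cos_eq hn hθ ((sq_eq_sq₀ ((hθ q).cos_nonneg hn)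
          ((hθ r).cos_nonneg hn)).1 hqr)
      -- A nonzero level set of `cos²θ` is closed by continuity and open by local constancy. If
      -- there is none, `θ = π/2` everywhere.
      have hS : {q | Real.cos (θ q) ^ 2 = Real.cos (θ p) ^ 2} = Set.univ := by
        refine IsClopen.eq_univ ⟨isClosed_eq (continuous_cos_sq hF hF' hθ) continuous_const,
          isOpen_iff_mem_nhds.2 fun q hq => ?_⟩ ⟨p, rfl⟩
        have hq' := hsq q p hq
        filter_upwards [h0 q (by rwa [hq'])] with r hr
        rw [hr, hq']
      exact ⟨θ p, fun q => hsq q p (by simpa using hS.ge (Set.mem_univ q))⟩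
    · push Not at hex
      refine ⟨Real.pi / 2, fun p => ?_⟩
      exact Real.injOn_cos
        ⟨((hθ p).2.1 ⟨0, hn⟩).1, ((hθ p).2.1 ⟨0, hn⟩).2.trans (by linarith [Real.pi_pos])⟩
        ⟨by positivity, by linarith [Real.pi_pos]⟩ (by rw [hex p, Real.cos_pi_div_two])
  · rintro ⟨c, hc⟩ p -
    exact Eventually.of_forall fun q => by rw [hc, hc]

omit [FiniteDimensional ℂ W] [IsManifold 𝓘(ℝ, V) ∞ M] in
theorem Jomega_apply_eq_zero_iff (hn : 1 ≤ n)
    (hF' : ∀ p, Function.Injective (mfderiv 𝓘(ℝ, V) 𝓘(ℝ, W) F p))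
    (hθ : HasEqualKahlerAngles V n h F θ) (hp : Real.cos (θ p) ≠ 0) (v : V) :
    Jomega V h F p v = 0 ↔ v = 0 := by
  constructor
  · intro hv
    have := Jomega_Jomega hn hF' hθ hp v
    rw [hv, map_zero, eq_comm, neg_eq_zero] at this
    exact this
  · rintro rfl
    exact map_zero _

end Divergence

end KahlerAngles

end

/-! ### The theorem. -/

open KahlerAngles in
theorem proposition3p3
    -- `N` is a Kähler manifold of complex dimension `2n`
    {n : ℕ} (hn : 1 ≤ n)
    {W : Type*} [NormedAddCommGroup W] [NormedSpace ℂ W] [FiniteDimensional ℂ W]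
    (hW : Module.finrank ℂ W = 2 * n)
    {N : Type*} [TopologicalSpace N] [ChartedSpace W N] [IsManifold 𝓘(ℂ, W) ∞ N]
    (h : HermitianMetric W N) (hN : h.IsKahler)
    -- `M` is a smooth manifold of real dimension `2n`
    {V : Type*} [NormedAddCommGroup V] [NormedSpace ℝ V] [FiniteDimensional ℝ V]
    (hV : Module.finrank ℝ V = 2 * n)
    {M : Type*} [TopologicalSpace M] [ChartedSpace V M] [IsManifold 𝓘(ℝ, V) ∞ M]
    -- `F : M → N` is an immersion with equal Kähler angles `θ`
    (F : M → N) (hF : ContMDiff 𝓘(ℝ, V) 𝓘(ℝ, W) ∞ F)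
    (hF' : ∀ p, Function.Injective (mfderiv 𝓘(ℝ, V) 𝓘(ℝ, W) F p))
    (θ : M → ℝ) (hθ : HasEqualKahlerAngles V n h F θ) :
    -- `cos θ` and `J_ω` are smooth on `Ω⁰_{2n}`
    ContMDiffOn 𝓘(ℝ, V) 𝓘(ℝ, ℝ) ∞ (fun q => Real.cos (θ q)) (constantRankSet V h F n) ∧
    (∀ p ∈ constantRankSet V h F n,
      ContDiffAt ℝ ∞ (chartEnd (Jomega V h F) p) (chartAt V p p)) ∧
    -- `δ F^*ω = (n - 2) J_ω (∇ cos θ)` and `cos θ δ J_ω = (n - 1) J_ω (∇ cos θ)` there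
    (∀ p ∈ constantRankSet V h F n,
      deltaEnd (inducedMetric V h F) (pullbackEnd V h F) p =
        ((n : ℝ) - 2) •
          Jomega V h F p (gradient (inducedMetric V h F) (fun q => Real.cos (θ q)) p)) ∧
    (∀ p ∈ constantRankSet V h F n,
      Real.cos (θ p) • deltaEnd (inducedMetric V h F) (Jomega V h F) p =
        ((n : ℝ) - 1) •
          Jomega V h F p (gradient (inducedMetric V h F) (fun q => Real.cos (θ q)) p)) ∧
    -- the codifferential of `F^*ω` as a 2-form is dual to that of `F^*ω` as an endomorphism
    (∀ p v, deltaForm (inducedMetric V h F) (pullbackForm V h F) p ![v] =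
      inducedMetric V h F p (deltaEnd (inducedMetric V h F) (pullbackEnd V h F) p) v) ∧
    -- `n = 1`
    (n = 1 →
      (∀ p ∈ constantRankSet V h F n,
        deltaEnd (inducedMetric V h F) (Jomega V h F) p = 0) ∧
      [∀ p, deltaForm (inducedMetric V h F) (pullbackForm V h F) p = 0,
        ∀ p ∈ constantRankSet V h F n,
          deltaEnd (inducedMetric V h F) (pullbackEnd V h F) p = 0,
        ∀ p ∈ constantRankSet V h F n, ∀ᶠ q in 𝓝 p, θ q = θ p].TFAE) ∧
    -- `n = 2`
    (n = 2 →
      (∀ p, deltaForm (inducedMetric V h F) (pullbackForm V h F) p = 0) ∧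
      (∀ p, hodgeLaplacian (inducedMetric V h F) (pullbackForm V h F) p = 0) ∧
      ((∀ p ∈ constantRankSet V h F n,
          deltaEnd (inducedMetric V h F) (Jomega V h F) p = 0) ↔
        ∀ p ∈ constantRankSet V h F n, ∀ᶠ q in 𝓝 p, θ q = θ p)) ∧
    -- `n ≥ 3`
    (3 ≤ n →
      [∀ p, deltaForm (inducedMetric V h F) (pullbackForm V h F) p = 0,
        ∀ p ∈ constantRankSet V h F n,
          deltaEnd (inducedMetric V h F) (pullbackEnd V h F) p = 0,
        ∀ p ∈ constantRankSet V h F n,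
          deltaEnd (inducedMetric V h F) (Jomega V h F) p = 0,
        ∀ p ∈ constantRankSet V h F n, ∀ᶠ q in 𝓝 p, θ q = θ p].TFAE) ∧
    -- on a connected manifold, `θ` is locally constant on `Ω⁰_{2n}` iff it is constant
    (PreconnectedSpace M →
      ((∀ p ∈ constantRankSet V h F n, ∀ᶠ q in 𝓝 p, θ q = θ p) ↔ ∃ c, ∀ p, θ p = c)) := by
  have : Nontrivial V := Module.nontrivial_of_finrank_pos (R := ℝ) (by omega)
  have mem : ∀ p, p ∈ constantRankSet V h F n ↔ Real.cos (θ p) ≠ 0 := fun p =>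
    mem_constantRankSet hn hV hF hF' hθ
  have divA := fun p hp => deltaEnd_pullbackEnd (p := p) hn hV hN hF hF' hθ hp
  have divJ := fun p hp => cos_smul_deltaEnd_Jomega (p := p) hn hV hN hF hF' hθ hp
  have grad := gradient_cos_eq_zero_iff hn hF hF' hθ
  have ker := fun p hp => Jomega_apply_eq_zero_iff (p := p) hn hF' hθ hp
  have const_to := deltaEnd_pullbackEnd_eq_zero_of_locallyConstant hV hN hF hF' hθ
  -- The coefficient `n - 2` is nonzero and `J_ω` is injective, so `δA = 0` forces the gradient to
  -- vanish.
  have to_const : n ≠ 2 → (∀ p, Real.cos (θ p) ≠ 0 →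
      deltaEnd (inducedMetric V h F) (pullbackEnd V h F) p = 0) →
      ∀ p, Real.cos (θ p) ≠ 0 → ∀ᶠ q in 𝓝 p, θ q = θ p := fun hn2 h0 =>
    grad.1 fun p hp => by
      have h1 := h0 p hp
      rw [divA p hp, smul_eq_zero, ker p hp] at h1
      exact h1.resolve_left (sub_ne_zero.2 (by exact_mod_cast hn2))
  -- The same argument with the coefficient `n - 1`; division by `cos θ ≠ 0` makes it an equivalence
  -- point by point.
  have J_iff : n ≠ 1 → ((∀ p, Real.cos (θ p) ≠ 0 →
      deltaEnd (inducedMetric V h F) (Jomega V h F) p = 0) ↔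
      ∀ p, Real.cos (θ p) ≠ 0 → ∀ᶠ q in 𝓝 p, θ q = θ p) := fun hn1 => by
    rw [← grad]
    refine forall₂_congr fun p hp => ?_
    have hn1' : (n : ℝ) - 1 ≠ 0 := sub_ne_zero.2 (by exact_mod_cast hn1)
    rw [← smul_eq_zero_iff_right hp, divJ p hp, smul_eq_zero_iff_right hn1', ker p hp]
  simp only [mem]
  refine ⟨fun p hp => (contMDiffAt_cos hn hF hF' hθ ((mem p).1 hp)).contMDiffWithinAt,
    fun p hp => contDiffAt_chartEnd_Jomega hn hF hF' hθ hp, divA, divJ,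
    fun p v => deltaForm_pullbackForm_apply hF hF' p v, ?_, ?_, ?_, ?_⟩
  · rintro rfl
    refine ⟨fun p hp => ?_, ?_⟩
    · have h1 := divJ p hp
      rw [Nat.cast_one, sub_self, zero_smul] at h1
      exact (smul_eq_zero.1 h1).resolve_left hp
    · simp only [deltaForm_pullbackForm_eq_zero_iff hF hF']
      tfae_have 1 → 2 := fun h0 p _ => h0 p
      tfae_have 2 → 3 := to_const (by norm_num)
      tfae_have 3 → 1 := const_to
      tfae_finish
  · rintro rfl
    have h0 : ∀ p, deltaForm (inducedMetric V h F) (pullbackForm V h F) p = 0 := fun p =>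
      (deltaForm_pullbackForm_eq_zero_iff hF hF' p).2
        -- For `n = 2` the coefficient `1 - n/2` is zero, whatever the derivative of `cos²θ` is.
        (deltaEnd_pullbackEnd_eq_zero hV hN hF hF' hθ fun y _ _ => by simp)
    exact ⟨h0, hodgeLaplacian_pullbackForm hN hF h0, J_iff (by norm_num)⟩
  · intro hn3
    simp only [deltaForm_pullbackForm_eq_zero_iff hF hF']
    tfae_have 1 → 2 := fun h0 p _ => h0 p
    tfae_have 2 → 4 := to_const (by omega)
    tfae_have 4 → 1 := const_to
    tfae_have 3 ↔ 4 := J_iff (by omega)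
    tfae_finish
  · intro _
    exact locallyConstant_iff_constant hn hF hF' hθ
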